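/- **Setting.** Let $m\ge 1$ and let $\Gamma$ be either (1) the free group on $s_1,\dots,s_m$, with $d=2m$, or (2) the free product of $m$ copies of $\mathbb{Z}/2\mathbb{Z}$ generated by involutions $s_1,\dots,s_m$, with $d=m$. The $d$-regular tree $T_d$ is the Cayley graph of $\Gamma$ with edges $\{w,ws_i\}$ and root $\phi=e$; $T_d(r)$ is the closed ball of radius $r$ about $\phi$. For each $n$ let $G_n=(V_n,E_n)$ be a finite nonempty simple $d$-regular graph whose edges are the pairs $\{u,\gamma^{(i)}_n(u)\}$ for permutations $\gamma^{(1)}_n,\dots,\gamma^{(m)}_n$ of $V_n$, with $(\gamma_n^{(i)})^2=\mathrm{id}$ in case (2). For a word $g\in\Gamma$ and $v\in V_n$, let $\gamma_n(g)(v)$ be the endpoint of the path from $v$ whose labels spell $g$, so that $\gamma_n(ws_i)(v)=\gamma_n^{(i)}(\gamma_n(w)(v))$; for $\sigma\in A^{V_n}$ let $\Pi_v^{\gamma_n}(\sigma)=(\sigma_{\gamma_n(g)(v)})_{g\in\Gamma}$. Assume that $G_n$ converges locally to $T_d$: for every $t$, the proportion of $v\in V_n$ with $B(v,t)\cong T_d(t)$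 tends to $1$. Let $A$ be a finite set and $\Phi=(\Phi_F)_{F\in\mathcal F}$, $\Phi_F:A^F\to[-\infty,\infty)$, an interaction on $T_d$, where $\mathcal F$ is a locally finite family of nonempty finite subsets of $\Gamma$. Assume $\Phi$ has finite range (the sets in $\mathcal F$ have bounded diameter) and is invariant under left translations by $\Gamma$. Let $\mathcal F_0\subseteq\mathcal F$ be a transversal for the translation action on $\mathcal F$. The Gibbs measure on $A^{V_n}$ derived from $\Phi$ is $\mu_n(\sigma)=Z_n^{-1}\exp U_n(\sigma)$, where $$U_n(\sigma)=\sum_{v\in V_n}\sum_{F\in\mathcal F_0}\frac{1}{|\{g\in\Gamma: gF=F\}|}\,\Phi_F\big(\Pi_v^{\gamma_n}(\sigma)|_F\big)$$ (the stabilizer is trivial in case (1)); assume that for every $n$ some $\sigma$ has $U_n(\sigma)>-\infty$. Let $\mu$ be a probability measure on $A^{T_d}$ such that $\mu_n$ converges to $\mu$ locally weak$^*$: for every $r\in\mathbb{N}$ and $\epsilon>0$, the proportion of $v\in V_n$ for which the law of $\Pi_v^{\gamma_n}(\sigma)|_{T_d(r)}$, $\sigma\sim\mu_n$, is at total variation distance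 more than $\epsilon$ from the marginal of $\mu$ on $T_d(r)$ tends to $0$. The percolative entropy is $$H_{perc}(\mu)=\int_0^1\int H_\mu\big(\sigma_\phi\,\big|\,\sigma_{S\setminus\{\phi\}}\big)\,\theta_p(dS)\,dp,$$ where $\theta_p$ is the law of the random set of vertices of $T_d$ containing each vertex independently with probability $p$, and $H$ is Shannon entropy. Let $\Omega$ be the set of $\xi\in A^{T_d}$ with $\Phi_F(\xi_F)>-\infty$ for all $F\in\mathcal F$. For a field $\Psi=(\Psi_v)_{v\in\Gamma}$, $\Psi_v:A\to\mathbb{R}$, a finite $S\subset \Gamma$ and $\eta\in\Omega$, let $\mu_{\Phi+\Psi,S,\eta}$ be the probability measure on $A^S$ with $\mu_{\Phi+\Psi,S,\eta}(\xi)\propto\exp\{\sum_{F\in\mathcal F,F\cap S\ne\emptyset}\Phi_F((\xi\vee\eta)_F)+\sum_{v\in S}\Psi_v(\xi_v)\}$, where $\xi\vee\eta$ equals $\xi$ on $S$ and $\eta$ off $S$. We say $\Phi$ exhibits strong spatial mixing if for every $a\in A$, as $r\to\infty$, $$\sup_{\Psi}\ \sup_{\eta,\tau\in\Omega}\big|\mu_{\Phi+\Psi,T_d(r),\eta}(\sigma_\phi=a)-\mu_{\Phi+\Psi,T_d(r),\tau}(\sigma_\phi=a)\big|\to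 0 .$$ **Theorem.** Under these assumptions, $$\limsup_{n\to\infty}\frac{1}{|V_n|}H(\mu_n)\le H_{perc}(\mu).$$ If, moreover, $\Phi$ exhibits strong spatial mixing, then $$\lim_{n\to\infty}\frac{1}{|V_n|}H(\mu_n)=H_{perc}(\mu).$$ -/

import Mathlib

open Filter Topology MeasureTheory ProbabilityTheory

namespace TreeGibbs

noncomputable section

/-! ### The group, its Cayley graph (the regular tree) and its balls -/

/-- The two ways of labelling the edges of the regular tree by the generators of a group:
by a free group, or by a free product of copies of `ℤ/2ℤ`. -/
inductive Labelling
  | free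
  | involutive

/-- Defining relations on `m` generators: none, respectively `sᵢ² = e` for every `i`. -/
def Labelling.relators (κ : Labelling) (m : ℕ) : Set (FreeGroup (Fin m)) :=
  match κ with
  | .free => ∅
  | .involutive => Set.range fun i => FreeGroup.of i ^ 2

/-- The degree `d` of the tree: `2m` for `m` free generators, `m` for `m` involutions. -/
def Labelling.degree (κ : Labelling) (m : ℕ) : ℕ :=
  match κ with
  | .free => 2 * m
  | .involutive => m

/-- The group `Γ`: the free group on `m` generators, or the free product of `m` copies
of `ℤ/2ℤ`. Its elements are the vertices of the tree; the root is `1`. -/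
abbrev TreeGroup (κ : Labelling) (m : ℕ) : Type := PresentedGroup (κ.relators m)

/-- The generator `sᵢ`. -/
def gen (κ : Labelling) {m : ℕ} (i : Fin m) : TreeGroup κ m := PresentedGroup.of i

/-- The tree `T_d`, as the Cayley graph with edges `{w, w sᵢ}`. -/
def cayleyTree (κ : Labelling) (m : ℕ) : SimpleGraph (TreeGroup κ m) :=
  SimpleGraph.fromRel fun w w' => ∃ i, w' = w * gen κ i

/-- The closed ball of radius `r` in the graph metric (unconnected vertices have infinite
distance). -/
def closedBall {V : Type*} (G : SimpleGraph V) (c : V) (r : ℕ) : Set V := {v | G.edist c v ≤ r}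

theorem closedBall_finite {V : Type*} (G : SimpleGraph V)
    (hG : ∀ v, (G.neighborSet v).Finite) (c : V) (r : ℕ) : (closedBall G c r).Finite := by
  induction r with
  | zero =>
    refine (Set.finite_singleton c).subset fun v hv => ?_
    simpa [closedBall] using hv
  | succ r ih =>
    refine (ih.union (ih.biUnion fun v _ => hG v)).subset fun v hv => ?_
    have hv' : G.edist c v ≤ ((r + 1 : ℕ) : ℕ∞) := hv
    obtain ⟨p, hp⟩ := SimpleGraph.exists_walk_of_edist_ne_top
      (ne_top_of_le_ne_top (ENat.natCast_ne_top _) hv')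
    rw [← hp] at hv'
    have hl : p.length ≤ r + 1 := by exact_mod_cast hv'
    have key : ∀ (n : ℕ) (x y : V) (q : G.Walk x y), q.length ≤ n + 1 →
        (y ∈ closedBall G x n) ∨ ∃ z ∈ closedBall G x n, y ∈ G.neighborSet z := by
      intro n x y q hq
      rcases Nat.lt_or_ge q.length (n + 1) with h | h
      · left
        exact (SimpleGraph.edist_le q).trans (by exact_mod_cast Nat.lt_succ_iff.1 h)
      · right
        have hnil : ¬ q.Nil := by
          intro hn
          have := SimpleGraph.Walk.length_eq_zero_iff.2 hn
          omega
        refine ⟨q.penultimate, ?_, SimpleGraph.Walk.adj_penultimate hnil⟩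
        refine (SimpleGraph.edist_le q.dropLast).trans ?_
        have := SimpleGraph.Walk.length_dropLast_add_one hnil
        exact_mod_cast (by omega : q.dropLast.length ≤ n)
    rcases key r c v p hl with h | ⟨z, hz, hzv⟩
    · exact Or.inl h
    · exact Or.inr (Set.mem_biUnion hz hzv)

theorem cayleyTree_neighborSet_finite (κ : Labelling) (m : ℕ) (w : TreeGroup κ m) :
    ((cayleyTree κ m).neighborSet w).Finite := by
  refine ((Set.finite_range fun i => w * gen κ i).union
    (Set.finite_range fun i => w * (gen κ i)⁻¹)).subset ?_
  rintro v ⟨-, ⟨i, hi⟩ | ⟨i, hi⟩⟩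
  · exact Or.inl ⟨i, hi.symm⟩
  · exact Or.inr ⟨i, by simp [hi]⟩

/-- The ball `T_d(r)` about the root. -/
def treeBall (κ : Labelling) (m r : ℕ) : Finset (TreeGroup κ m) :=
  (closedBall_finite (cayleyTree κ m) (cayleyTree_neighborSet_finite κ m) 1 r).toFinset

/-! ### Finite edge-labelled regular graphs -/

/-- The graph with edges `{u, γᵢ(u)}`. -/
def permGraph {m : ℕ} {V : Type*} (γ : Fin m → Equiv.Perm V) : SimpleGraph V :=
  SimpleGraph.fromRel fun u v => ∃ i, γ i u = v

/-- A `d`-regular simple graph on `V` generated by permutations `γ₁, …, γₘ` of `V`, which are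
involutions if the generators of the group are: the edge `{u, γᵢ(u)}` is labelled by `i` (and
directed from `u` to `γᵢ(u)`). Regularity of degree `d` forces the labels to be unambiguous. -/
structure LabelledGraph (κ : Labelling) (m : ℕ) (V : Type*) where
  perm : Fin m → Equiv.Perm V
  involutive : κ = .involutive → ∀ i u, perm i (perm i u) = u
  regular : ∀ u, ((permGraph perm).neighborSet u).ncard = κ.degree m

namespace LabelledGraph

variable {κ : Labelling} {m : ℕ} {V : Type*}

/-- The underlying simple graph. -/
def graph (G : LabelledGraph κ m V) : SimpleGraph V := permGraph G.perm

theorem lift_relators (G : LabelledGraph κ m V) :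
    ∀ r ∈ κ.relators m, FreeGroup.lift (fun i => MulOpposite.op (G.perm i)) r = 1 := by
  cases κ with
  | free => intro r hr; exact hr.elim
  | involutive =>
    rintro r ⟨i, rfl⟩
    have h : G.perm i * G.perm i = 1 := Equiv.ext fun u => G.involutive rfl i u
    simp [pow_two, ← MulOpposite.op_mul, h]

/-- The group homomorphism `γ : Γ → Sym(V)` with `γ(sᵢ) = γᵢ`. Products of permutations are read
from left to right (hence the opposite group), so that `γ(w sᵢ)(v) = γᵢ(γ(w)(v))`. -/
def hom (G : LabelledGraph κ m V) : TreeGroup κ m →* (Equiv.Perm V)ᵐᵒᵖ :=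
  PresentedGroup.toGroup G.lift_relators

/-- `γ(g)(v)`: the endpoint of the path from `v` whose labels spell the word `g`. -/
def act (G : LabelledGraph κ m V) (g : TreeGroup κ m) (v : V) : V := (G.hom g).unop v

/-- `g ↦ γ(g)(v)` follows the labelled edges of the tree. -/
theorem act_mul_gen (G : LabelledGraph κ m V) (w : TreeGroup κ m) (i : Fin m) (v : V) :
    G.act (w * gen κ i) v = G.perm i (G.act w v) := by
  simp [act, hom, gen]

/-- The pull-back name `(x_{γ(g)(v)})_{g ∈ Γ}` of `x ∈ A^V` at `v`. -/
def pullback {A : Type*} (G : LabelledGraph κ m V) (v : V) (x : V → A) : TreeGroup κ m → A :=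
  fun g => x (G.act g v)

end LabelledGraph

/-- The probability of an event under the uniform distribution on a finite set. -/
def uniformProb {V : Type*} (P : V → Prop) : ℝ := (Nat.card {v // P v} : ℝ) / Nat.card V

/-- Local convergence of `G_n` to the tree: for every `t`, the ball `B(v, t)` is isomorphic to
`T_d(t)` as a graph, with probability tending to one for a uniform vertex `v` of `G_n`. -/
def LocallyConverges {κ : Labelling} {m : ℕ} {V : ℕ → Type*}
    (G : ∀ n, LabelledGraph κ m (V n)) : Prop :=
  ∀ t : ℕ, Tendsto (fun n => uniformProb fun v : V n =>
    Nonempty ((G n).graph.induce (closedBall (G n).graph v t) ≃g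
      (cayleyTree κ m).induce (closedBall (cayleyTree κ m) 1 t))) atTop (𝓝 1)

/-! ### Interactions -/

/-- An interaction on `V` with spins in `A`: a locally finite family of nonempty finite sets `F`
and, for each of them, a function `Φ_F : A^F → [-∞, ∞)`. (The values of `val` on sets outside
the family are never used.) -/
structure Interaction (V A : Type*) where
  sets : Set (Finset V)
  nonempty : ∀ F ∈ sets, F.Nonempty
  locallyFinite : ∀ v, {F ∈ sets | v ∈ F}.Finite
  val : (F : Finset V) → (F → A) → WithBot ℝ

/-- `exp : [-∞, ∞) → [0, ∞)`, with `exp(-∞) = 0`. -/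
def expBot (x : WithBot ℝ) : ℝ := x.recBotCoe 0 Real.exp

namespace Interaction

section general

variable {V A : Type*}

/-- `Ω`: the configurations with finite local energies. -/
def admissible (Φ : Interaction V A) : Set (V → A) :=
  {ξ | ∀ F ∈ Φ.sets, Φ.val F (F.restrict ξ) ≠ ⊥}

theorem finite_meeting (Φ : Interaction V A) (S : Finset V) :
    {F ∈ Φ.sets | ∃ v ∈ S, v ∈ F}.Finite := by
  refine (S.finite_toSet.biUnion fun v _ => Φ.locallyFinite v).subset ?_
  rintro F ⟨hF, v, hv, hvF⟩
  exact Set.mem_biUnion (Finset.mem_coe.2 hv) ⟨hF, hvF⟩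

/-- The sum of `Φ_F(ω_F)` over all `F` that meet the finite set `S`. -/
def localEnergy (Φ : Interaction V A) (S : Finset V) (ω : V → A) : WithBot ℝ :=
  ∑ F ∈ (Φ.finite_meeting S).toFinset, Φ.val F (F.restrict ω)

open Classical in
/-- `ξ ∨ η`: the configuration equal to `ξ` on `S` and to `η` off `S`. -/
def glue (S : Finset V) (ξ : S → A) (η : V → A) : V → A :=
  fun v => if h : v ∈ S then ξ ⟨v, h⟩ else η v

/-- The Boltzmann weight of `ξ ∈ A^S` for the interaction `Φ + Ψ` and the boundary condition
`η` (of which only the restriction to the complement of `S` matters), where `Ψ` is an external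
field (self-interaction). -/
def condWeight (Φ : Interaction V A) (Ψ : V → A → ℝ) (S : Finset V) (η : V → A) (ξ : S → A) : ℝ :=
  expBot (Φ.localEnergy S (glue S ξ η) + ((∑ v : S, Ψ v (ξ v) : ℝ) : WithBot ℝ))

open Classical in
/-- The probability that the spin at `v` is `a` under the conditional Gibbs measure
`μ_{Φ + Ψ, S, η}` on `A^S`. -/
def condProb [Fintype A] (Φ : Interaction V A) (Ψ : V → A → ℝ) (S : Finset V) (η : V → A)
    (v : V) (a : A) : ℝ :=
  (∑ ξ : S → A, if glue S ξ η v = a then Φ.condWeight Ψ S η ξ else 0) /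
    ∑ ξ : S → A, Φ.condWeight Ψ S η ξ

end general

section tree

variable {κ : Labelling} {m : ℕ} {A : Type*}

/-- The translate `gF`. -/
def translate (g : TreeGroup κ m) (F : Finset (TreeGroup κ m)) : Finset (TreeGroup κ m) :=
  F.map (mulLeftEmbedding g)

/-- Invariance under all translations of the tree (which are label-preserving automorphisms
`h ↦ gh` of the Cayley graph). -/
structure IsTranslationInvariant (Φ : Interaction (TreeGroup κ m) A) : Prop where
  sets : ∀ g, ∀ F ∈ Φ.sets, translate g F ∈ Φ.sets
  val : ∀ g, ∀ F ∈ Φ.sets, ∀ ξ : TreeGroup κ m → A,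
    Φ.val (translate g F) ((translate g F).restrict ξ) = Φ.val F (F.restrict fun h => ξ (g * h))

/-- Finite range: the sets in the family have uniformly bounded diameters. -/
def IsFiniteRange (Φ : Interaction (TreeGroup κ m) A) : Prop :=
  ∃ R : ℕ, ∀ F ∈ Φ.sets, ∀ g ∈ F, ∀ h ∈ F, (cayleyTree κ m).edist g h ≤ R

/-- `T` contains exactly one member of each translation orbit of the family of `Φ`. -/
def IsTransversal (Φ : Interaction (TreeGroup κ m) A) (T : Finset (Finset (TreeGroup κ m))) :
    Prop :=
  (∀ F ∈ T, F ∈ Φ.sets) ∧ ∀ F ∈ Φ.sets, ∃! F₀, F₀ ∈ T ∧ ∃ g, translate g F₀ = F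

/-- The number of translations that map the set `F` onto itself. It is `1` in the free group; in
the free product of copies of `ℤ/2ℤ` it can be `2`, for instance for an edge. -/
def stabilizerCard (F : Finset (TreeGroup κ m)) : ℕ := Nat.card {g // translate g F = F}

/-- The Hamiltonian derived from `Φ` on a finite labelled graph: the sum over vertices `v` and
over `F` in a transversal of `Φ_F` at the pull-back name at `v`. If `k` translations stabilize `F`,
each translate of `F` arises from `k` base points `v`; dividing by `k` counts it once. -/
def hamiltonian {V : Type*} [Fintype V] (Φ : Interaction (TreeGroup κ m) A)
    (T : Finset (Finset (TreeGroup κ m))) (G : LabelledGraph κ m V) (σ : V → A) : WithBot ℝ :=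
  ∑ v : V, ∑ F ∈ T,
    (Φ.val F (F.restrict (G.pullback v σ))).map fun x : ℝ => x / stabilizerCard F

open Classical in
/-- The Gibbs measure derived from `Φ` on a finite labelled graph. -/
def gibbs {V : Type*} [Fintype V] [Fintype A] [MeasurableSpace A]
    (Φ : Interaction (TreeGroup κ m) A) (T : Finset (Finset (TreeGroup κ m)))
    (G : LabelledGraph κ m V) : Measure (V → A) :=
  ∑ σ : V → A, ENNReal.ofReal
    (expBot (Φ.hamiltonian T G σ) / ∑ τ : V → A, expBot (Φ.hamiltonian T G τ)) • Measure.dirac σ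

/-- Strong spatial mixing: the influence of the boundary condition outside `T_d(r)` on the spin at
the root tends to zero as `r → ∞`, uniformly over all external fields. -/
def StrongSpatialMixing [Fintype A] (Φ : Interaction (TreeGroup κ m) A) : Prop :=
  ∀ ε : ℝ, 0 < ε → ∃ R : ℕ, ∀ r ≥ R, ∀ Ψ : TreeGroup κ m → A → ℝ,
    ∀ η ∈ Φ.admissible, ∀ τ ∈ Φ.admissible, ∀ a : A,
      |Φ.condProb Ψ (treeBall κ m r) η 1 a - Φ.condProb Ψ (treeBall κ m r) τ 1 a| ≤ ε

end tree

end Interaction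

/-! ### Local weak* convergence and entropies -/

/-- Total variation distance of two finite measures. -/
def tvDist {X : Type*} [MeasurableSpace X] (P Q : Measure X) : ℝ :=
  ⨆ s : {s : Set X // MeasurableSet s}, |P.real s - Q.real s|

/-- Local weak* convergence of measures `μ_n` on `A^{V_n}` to `μ` on `A^{T_d}`. -/
def LocalWeakStar {κ : Labelling} {m : ℕ} {V : ℕ → Type*} {A : Type*} [MeasurableSpace A]
    (G : ∀ n, LabelledGraph κ m (V n)) (μn : ∀ n, Measure (V n → A))
    (μ : Measure (TreeGroup κ m → A)) : Prop :=
  ∀ r : ℕ, ∀ ε : ℝ, 0 < ε → Tendsto (fun n => uniformProb fun v : V n =>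
    ε < tvDist ((μn n).map fun x => (treeBall κ m r).restrict ((G n).pullback v x))
      (μ.map (treeBall κ m r).restrict)) atTop (𝓝 0)

open Classical in
/-- Shannon entropy of a probability measure on the finite set `A^V`. -/
def shannonEntropy {V A : Type*} [Fintype V] [Fintype A] [MeasurableSpace A]
    (P : Measure (V → A)) : ℝ :=
  ∑ σ : V → A, Real.negMulLog (P.real {σ})

/-- The conditional Shannon entropy `H_μ(σ_v | σ_S)` of the spin at `v` given the spins in `S`. -/
def condEntropy {V A : Type*} [Fintype A] [MeasurableSpace A] (μ : Measure (V → A))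
    (v : V) (S : Set V) : ℝ :=
  ∫ σ, ∑ a : A, Real.negMulLog
    ((μ⟦{τ : V → A | τ v = a} |
      MeasurableSpace.comap (fun (τ : V → A) (s : S) => τ s) MeasurableSpace.pi⟧) σ) ∂μ

/-- Percolative entropy: the average over `p ∈ [0, 1]` and over a `p`-Bernoulli random set `S` of
vertices of the conditional entropy of the spin at the root given the spins in `S` without the
root. -/
def percolativeEntropy {κ : Labelling} {m : ℕ} {A : Type*} [Fintype A] [MeasurableSpace A]
    (μ : Measure (TreeGroup κ m → A)) : ℝ :=
  ∫ p : unitInterval, ∫ S : Set (TreeGroup κ m), condEntropy μ 1 (S \ {1})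
    ∂(setBernoulli Set.univ p)

end

end TreeGibbs

/-! Reveal the spins of $G_n$ one at a time, in a uniformly random order of the vertices. By the
chain rule, $H(\mu_n)$ is the sum over $v$ of the expected entropy of $\sigma_v$ given the spins
already revealed. With independent uniform revelation times, the vertices preceding $v$ form a
$p$-Bernoulli set, where $p$ is the time of $v$. The proof reaches this identity analytically. The
expected entropy of the spins in a $p$-Bernoulli set is a polynomial in $p$ that runs from $0$ to
$H(\mu_n)$, and Russo's formula (`hasDerivAt_bernAvg`) writes its derivative as a sum of conditional
entropies. Hence $H(\mu_n)/|V_n|$ is the average of `vertexEntropy`, the finite-graph analogue of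
$H_{perc}$ (`shannonEntropy_eq_sum_vertexEntropy`).

Upper bound: at most vertices the covering $g \mapsto \gamma_n(g)(v)$ is injective on a given ball.
Forgetting the revealed spins outside the image of that ball can only raise the conditional entropy.
What remains depends only on the law of the spins in the ball, and continuously so; local weak*
convergence brings it close to `localPercolativeEntropy` of $\mu$. This tends to $H_{perc}(\mu)$ as
the radius grows, by martingale convergence. The exceptional vertices have density $o(1)$ and
contribute at most $|A|$ each.

Lower bound: under strong spatial mixing, forgetting those spins costs little. The weights near $v$
are those of the tree (`boltzmann_eq_farFactor_mul`). So the law of $\sigma_v$, given some spins in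
the ball and all spins outside it, is a conditional Gibbs measure on the tree with some spins pinned
(`spinProb_gibbs`). Pinning is a limit of strong external fields, and mixing is uniform over fields.
Hence the outside spins hardly move the conditional probabilities (`condEntropy_gibbs_le_add`). -/

namespace TreeGibbs

noncomputable section

/-! ### Conditional entropy of a spin -/

section condEntropy

variable {V A : Type*}

/-- The σ-algebra generated by the spins in `S`. -/
abbrev spinSigma [MeasurableSpace A] (S : Set V) : MeasurableSpace (V → A) :=
  MeasurableSpace.comap (fun (τ : V → A) (s : S) => τ s) MeasurableSpace.pi

variable [MeasurableSpace A]

theorem spinSigma_le (S : Set V) : spinSigma (A := A) S ≤ MeasurableSpace.pi := by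
  rw [← measurable_iff_comap_le]
  fun_prop

theorem spinSigma_eq_iSup (S : Set V) :
    spinSigma (A := A) S =
      ⨆ s : S, MeasurableSpace.comap (fun τ : V → A => τ s) inferInstance := by
  simp only [spinSigma, MeasurableSpace.pi, MeasurableSpace.comap_iSup,
    MeasurableSpace.comap_comp]
  rfl

theorem spinSigma_mono {S T : Set V} (h : S ⊆ T) : spinSigma (A := A) S ≤ spinSigma T := by
  simp only [spinSigma_eq_iSup]
  exact iSup_le fun s => le_iSup (fun t : T => MeasurableSpace.comap (fun τ : V → A => τ t)
    inferInstance) ⟨s, h s.2⟩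

theorem iSup_spinSigma {ι : Type*} (S : ι → Set V) :
    ⨆ n, spinSigma (A := A) (S n) = spinSigma (⋃ n, S n) := by
  refine le_antisymm (iSup_le fun n => spinSigma_mono (Set.subset_iUnion S n)) ?_
  rw [spinSigma_eq_iSup]
  refine iSup_le fun s => ?_
  obtain ⟨n, hn⟩ := Set.mem_iUnion.1 s.2
  refine le_trans ?_ (le_iSup _ n)
  rw [spinSigma_eq_iSup]
  exact le_iSup (fun t : S n => MeasurableSpace.comap (fun τ : V → A => τ t)
    inferInstance) ⟨s, hn⟩

theorem aestronglyMeasurable_negMulLog_condExp (μ : Measure (V → A)) (v : V) (a : A) (S : Set V) :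
    AEStronglyMeasurable
      (fun σ => Real.negMulLog ((μ⟦{τ : V → A | τ v = a} | spinSigma S⟧) σ)) μ :=
  Real.continuous_negMulLog.comp_aestronglyMeasurable integrable_condExp.aestronglyMeasurable

variable [MeasurableSingletonClass A] (μ : Measure (V → A)) [IsProbabilityMeasure μ]

theorem measurableSet_spin_eq (v : V) (a : A) : MeasurableSet {τ : V → A | τ v = a} :=
  (measurable_pi_apply v : Measurable fun τ : V → A => τ v) (measurableSet_singleton a)

theorem integrable_indicator_spin (v : V) (a : A) :
    Integrable ({τ : V → A | τ v = a}.indicator fun _ => (1 : ℝ)) μ :=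
  (integrable_const 1).indicator (measurableSet_spin_eq v a)

theorem condExp_spin_mem_Icc (v : V) (a : A) (S : Set V) :
    ∀ᵐ σ ∂μ, (μ⟦{τ : V → A | τ v = a} | spinSigma S⟧) σ ∈ Set.Icc (0 : ℝ) 1 := by
  refine Convex.condExp_mem (spinSigma_le S) (integrable_indicator_spin μ v a) isClosed_Icc
    (convex_Icc 0 1) (ae_of_all _ fun σ => ?_)
  by_cases h : σ ∈ {τ : V → A | τ v = a} <;> simp [h]

theorem negMulLog_mem_Icc {x : ℝ} (hx : x ∈ Set.Icc (0 : ℝ) 1) :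
    Real.negMulLog x ∈ Set.Icc (0 : ℝ) 1 :=
  ⟨Real.negMulLog_nonneg hx.1 hx.2,
    (Real.negMulLog_le_one_sub_self hx.1).trans (by linarith [hx.1])⟩

theorem integrable_negMulLog_condExp (v : V) (a : A) (S : Set V) :
    Integrable (fun σ => Real.negMulLog ((μ⟦{τ : V → A | τ v = a} | spinSigma S⟧) σ)) μ := by
  refine Integrable.of_bound (aestronglyMeasurable_negMulLog_condExp μ v a S) 1 ?_
  filter_upwards [condExp_spin_mem_Icc μ v a S] with σ hσ
  have := negMulLog_mem_Icc hσ
  rw [Real.norm_eq_abs, abs_le]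
  exact ⟨by linarith [this.1], this.2⟩

variable [Fintype A]

theorem condEntropy_eq_sum (v : V) (S : Set V) :
    condEntropy μ v S =
      ∑ a : A, ∫ σ, Real.negMulLog ((μ⟦{τ : V → A | τ v = a} | spinSigma S⟧) σ) ∂μ :=
  integral_finsetSum _ fun a _ => integrable_negMulLog_condExp μ v a S

theorem condEntropy_nonneg (v : V) (S : Set V) : 0 ≤ condEntropy μ v S := by
  rw [condEntropy_eq_sum]
  refine Finset.sum_nonneg fun a _ => integral_nonneg_of_ae ?_
  filter_upwards [condExp_spin_mem_Icc μ v a S] with σ hσ using (negMulLog_mem_Icc hσ).1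

theorem condEntropy_le (v : V) (S : Set V) : condEntropy μ v S ≤ Fintype.card A := by
  rw [condEntropy_eq_sum]
  have h (a : A) :
      ∫ σ, Real.negMulLog ((μ⟦{τ : V → A | τ v = a} | spinSigma S⟧) σ) ∂μ ≤ 1 := by
    have : ∫ _ : V → A, (1 : ℝ) ∂μ = 1 := by simp
    refine le_of_le_of_eq ?_ this
    refine integral_mono_ae (integrable_negMulLog_condExp μ v a S) (integrable_const 1) ?_
    filter_upwards [condExp_spin_mem_Icc μ v a S] with σ hσ using (negMulLog_mem_Icc hσ).2
  calc _ ≤ ∑ _ : A, (1 : ℝ) := Finset.sum_le_sum fun a _ => h a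
    _ = _ := by simp

/-- Conditioning on more spins does not increase the entropy. -/
theorem condEntropy_anti (v : V) {S T : Set V} (h : S ⊆ T) :
    condEntropy μ v T ≤ condEntropy μ v S := by
  rw [condEntropy_eq_sum, condEntropy_eq_sum]
  refine Finset.sum_le_sum fun a _ => ?_
  -- Conditional Jensen for the concave function $-x\log x$, applied to the probability given $T$;
  -- by the tower property, its conditional expectation given $S$ is the probability given $S$.
  have hT := condExp_spin_mem_Icc μ v a T
  have key := Real.concaveOn_negMulLog.subset (Set.Icc_subset_Ici_self : Set.Icc (0 : ℝ) 1 ⊆ _)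
    (convex_Icc 0 1) |>.condExp_map_le (spinSigma_le (A := A) S)
    Real.continuous_negMulLog.continuousOn.upperSemicontinuousOn hT isClosed_Icc
    integrable_condExp (integrable_negMulLog_condExp μ v a T)
  have tower := condExp_condExp_of_le (μ := μ) (spinSigma_mono (A := A) h) (spinSigma_le T)
    (f := {τ : V → A | τ v = a}.indicator fun _ => (1 : ℝ))
  rw [← integral_condExp (spinSigma_le S)
    (f := fun σ => Real.negMulLog ((μ⟦{τ : V → A | τ v = a} | spinSigma T⟧) σ))]
  refine integral_mono_ae integrable_condExp (integrable_negMulLog_condExp μ v a S) ?_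
  filter_upwards [key, tower] with σ h1 h2
  simp only [Function.comp_apply, h2] at h1
  exact h1

/-- The conditional entropy is continuous along increasing sequences of conditioning sets. -/
theorem tendsto_condEntropy_iUnion (v : V) {S : ℕ → Set V} (hS : Monotone S) :
    Tendsto (fun n => condEntropy μ v (S n)) atTop (𝓝 (condEntropy μ v (⋃ n, S n))) := by
  simp only [condEntropy_eq_sum]
  refine tendsto_finsetSum _ fun a _ => ?_
  -- Lévy's upward theorem for the filtration of the spins in $S_n$; bounded convergence then passes
  -- it through $-x\log x$ and the integral.
  let ℱ : Filtration ℕ (MeasurableSpace.pi : MeasurableSpace (V → A)) :=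
    { seq := fun n => spinSigma (S n)
      mono' := fun i j hij => spinSigma_mono (hS hij)
      le' := fun i => spinSigma_le _ }
  have hlim := tendsto_ae_condExp (μ := μ) (ℱ := ℱ)
    ({τ : V → A | τ v = a}.indicator fun _ => (1 : ℝ))
  have hsup : (⨆ n, ℱ n) = spinSigma (A := A) (⋃ n, S n) := iSup_spinSigma S
  rw [hsup] at hlim
  refine tendsto_integral_of_dominated_convergence (fun _ => (1 : ℝ))
    (fun n => aestronglyMeasurable_negMulLog_condExp μ v a (S n)) (integrable_const 1)
    (fun n => ?_) ?_
  · filter_upwards [condExp_spin_mem_Icc μ v a (S n)] with σ hσ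
    have := negMulLog_mem_Icc hσ
    rw [Real.norm_eq_abs, abs_le]
    exact ⟨by linarith [this.1], this.2⟩
  · filter_upwards [hlim] with σ hσ
    exact (Real.continuous_negMulLog.tendsto _).comp hσ

end condEntropy

/-! ### Entropies of finitely many spins -/

section finite

theorem integral_comp_eq_sum {Ω K : Type*} [MeasurableSpace Ω] [Fintype K] [MeasurableSpace K]
    [MeasurableSingletonClass K] (μ : Measure Ω) [IsFiniteMeasure μ] {X : Ω → K}
    (hX : Measurable X) (f : K → ℝ) :
    ∫ ω, f (X ω) ∂μ = ∑ k, μ.real (X ⁻¹' {k}) * f k := by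
  have hf : AEStronglyMeasurable f (μ.map X) := (measurable_of_finite f).aestronglyMeasurable
  rw [← integral_map hX.aemeasurable hf, integral_fintype .of_finite]
  refine Finset.sum_congr rfl fun k _ => ?_
  rw [map_measureReal_apply hX (measurableSet_singleton k), smul_eq_mul]

variable {V A : Type*}

/-- The configurations whose restriction to `S` is `ζ`. -/
abbrev spinCylinder (S : Finset V) (ζ : S → A) : Set (V → A) :=
  (S.restrict : (V → A) → (S → A)) ⁻¹' {ζ}

/-- The configurations that agree with `σ` on `S`. -/
def agreeSet (S : Finset V) (σ : V → A) : Set (V → A) := {τ | ∀ s ∈ S, τ s = σ s}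

theorem restrict_preimage_singleton (S : Finset V) (σ : V → A) :
    spinCylinder S (S.restrict σ) = agreeSet S σ := by
  ext τ
  simp only [agreeSet, Set.mem_preimage, Set.mem_singleton_iff, funext_iff, Finset.restrict]
  exact ⟨fun h s hs => h ⟨s, hs⟩, fun h s => h s s.2⟩

theorem agreeSet_eq_of_mem {S : Finset V} {σ τ : V → A} (h : τ ∈ agreeSet S σ) :
    agreeSet S τ = agreeSet S σ := by
  ext ρ
  exact forall₂_congr fun s hs => by rw [h s hs]

theorem agreeSet_anti {S T : Finset V} (h : S ⊆ T) (σ : V → A) : agreeSet T σ ⊆ agreeSet S σ :=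
  fun _ hτ s hs => hτ s (h hs)

variable [MeasurableSpace A]

/-- The conditional probability that the spin at `v` is `a`, given that the configuration agrees
with `σ` on `S`. -/
def spinProb (μ : Measure (V → A)) (v : V) (S : Finset V) (σ : V → A) (a : A) : ℝ :=
  μ.real ({τ | τ v = a} ∩ agreeSet S σ) / μ.real (agreeSet S σ)

theorem spinProb_nonneg (μ : Measure (V → A)) (v : V) (S : Finset V) (σ : V → A) (a : A) : 0 ≤ spinProb μ v S σ a :=
  div_nonneg measureReal_nonneg measureReal_nonneg

theorem spinProb_le_one (μ : Measure (V → A)) [IsProbabilityMeasure μ] (v : V) (S : Finset V) (σ : V → A) (a : A) : spinProb μ v S σ a ≤ 1 :=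
  div_le_one_of_le₀ (measureReal_mono Set.inter_subset_right) measureReal_nonneg

theorem spinProb_mem_Icc (μ : Measure (V → A)) [IsProbabilityMeasure μ] (v : V) (S : Finset V) (σ : V → A) (a : A) :
    spinProb μ v S σ a ∈ Set.Icc (0 : ℝ) 1 :=
  ⟨spinProb_nonneg μ v S σ a, spinProb_le_one μ v S σ a⟩

/-- There are only finitely many cylinders over $S$, so the null ones have a null union. -/
theorem ae_agreeSet_pos [Fintype A] (μ : Measure (V → A)) [IsProbabilityMeasure μ] (S : Finset V) :
    ∀ᵐ σ ∂μ, 0 < μ.real (agreeSet S σ) := by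
  classical
  have h : {σ : V → A | ¬ 0 < μ.real (agreeSet S σ)} =
      ⋃ ζ ∈ {ζ : S → A | μ (spinCylinder S ζ) = 0}, spinCylinder S ζ := by
    ext σ
    simp only [Set.mem_ofPred_eq, Set.mem_iUnion, Set.mem_preimage, Set.mem_singleton_iff,
      exists_prop, exists_eq_right', restrict_preimage_singleton]
    rw [measureReal_def, ENNReal.toReal_pos_iff]
    simp [measure_lt_top]
  rw [ae_iff, h, measure_biUnion_null_iff (Set.to_countable _)]
  exact fun ζ hζ => hζ

theorem measurable_restrict (S : Finset V) : Measurable (S.restrict : (V → A) → (S → A)) := by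
  fun_prop

variable [MeasurableSingletonClass A]

theorem measurableSet_agreeSet (S : Finset V) (σ : V → A) :
    MeasurableSet[spinSigma (S : Set V)] (agreeSet S σ) :=
  ⟨{(S.restrict σ : S → A)}, measurableSet_singleton _, restrict_preimage_singleton S σ⟩

theorem measurableSet_agreeSet_pi (S : Finset V) (σ : V → A) :
    MeasurableSet (agreeSet S σ) :=
  spinSigma_le _ _ (measurableSet_agreeSet S σ)

variable [Fintype A]

/-- The Shannon entropy of the spins in a finite set. -/
def blockEntropy (μ : Measure (V → A)) (S : Finset V) : ℝ :=
  open scoped Classical in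
  ∑ ζ : S → A, Real.negMulLog (μ.real (spinCylinder S ζ))

variable (μ : Measure (V → A)) [IsProbabilityMeasure μ]

/-- Entropy as expected information. In this form it is easily transported along maps and compared
between different index sets. -/
theorem blockEntropy_eq_integral (S : Finset V) :
    blockEntropy μ S = -∫ σ, Real.log (μ.real (agreeSet S σ)) ∂μ := by
  classical
  have := integral_comp_eq_sum μ (measurable_restrict S)
    (fun ζ => Real.log (μ.real (spinCylinder S ζ)))
  simp only [restrict_preimage_singleton S] at this
  rw [this, blockEntropy, ← Finset.sum_neg_distrib]
  exact Finset.sum_congr rfl fun ζ _ => by rw [Real.negMulLog, neg_mul]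

/-- The σ-algebra of finitely many spins is generated by the finite partition into cylinders, so the
elementary conditional probability is a version of the conditional expectation. -/
theorem condExp_spin_ae_eq (v : V) (a : A) (S : Finset V) :
    μ⟦{τ : V → A | τ v = a} | spinSigma (S : Set V)⟧ =ᵐ[μ] fun σ => spinProb μ v S σ a := by
  classical
  let f : (S → A) → ℝ := fun ζ =>
    μ.real ({τ | τ v = a} ∩ spinCylinder S ζ) / μ.real (spinCylinder S ζ)
  have hf : (fun σ => spinProb μ v S σ a) = fun σ => f (S.restrict σ) := by
    funext σ
    simp only [f, spinProb, restrict_preimage_singleton]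
  have hmeas : Measurable[spinSigma (S : Set V)] fun σ : V → A => f (S.restrict σ) :=
    (measurable_of_finite f).comp (comap_measurable _)
  have hint : Integrable (fun σ : V → A => f (S.restrict σ)) μ := by
    refine Integrable.of_bound (hmeas.mono (spinSigma_le _) le_rfl).aestronglyMeasurable
      (∑ ζ, ‖f ζ‖) (ae_of_all _ fun σ => ?_)
    exact Finset.single_le_sum (f := fun ζ => ‖f ζ‖) (fun ζ _ => norm_nonneg _)
      (Finset.mem_univ _)
  rw [hf]
  refine (ae_eq_condExp_of_forall_setIntegral_eq (spinSigma_le _)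
    (integrable_indicator_spin μ v a) (fun s _ _ => hint.integrableOn) ?_
    hmeas.stronglyMeasurable.aestronglyMeasurable).symm
  rintro s ⟨t, -, rfl⟩ -
  have ht : MeasurableSet ((fun (τ : V → A) (s : (S : Set V)) => τ s) ⁻¹' t) :=
    spinSigma_le _ _ ⟨t, .of_discrete, rfl⟩
  -- Both integrals become finite sums: one over the values of the spins in $S$, the other over the
  -- joint values of these and the spin at $v$.
  rw [← integral_indicator ht, ← integral_indicator ht]
  have h1 := integral_comp_eq_sum μ (measurable_restrict S) (t.indicator f)
  have h2 := integral_comp_eq_sum μ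
    ((measurable_pi_apply v : Measurable fun τ : V → A => τ v).prodMk (measurable_restrict S))
    (fun k => ({k : A × (S → A) | k.1 = a ∧ k.2 ∈ t}.indicator (fun _ => (1 : ℝ))) k)
  refine Eq.trans (Eq.trans ?_ h1) (Eq.trans ?_ (h2.symm.trans ?_))
  · refine integral_congr_ae (ae_of_all _ fun σ => ?_)
    rfl
  · rw [Fintype.sum_prod_type, Finset.sum_eq_single a]
    · refine Finset.sum_congr rfl fun ζ _ => ?_
      have hpre : (fun τ : V → A => (τ v, S.restrict τ)) ⁻¹' {(a, ζ)} =
          {τ | τ v = a} ∩ spinCylinder S ζ := by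
        ext τ; simp
      by_cases hζ : ζ ∈ t
      · rw [hpre]
        simp only [Set.indicator_of_mem hζ, f, Set.mem_ofPred_eq, hζ, and_self,
          Set.indicator_of_mem, mul_one]
        -- On a null cylinder the quotient is $0/0 = 0$, and the numerator vanishes as well.
        by_cases h0 : μ.real (spinCylinder S ζ) = 0
        · rw [h0, zero_mul]
          exact (le_antisymm ((measureReal_mono Set.inter_subset_right).trans h0.le)
            measureReal_nonneg).symm
        · field_simp
      · simp [hζ]
    · intro b _ hb
      simp [hb]
    · simp
  · refine integral_congr_ae (ae_of_all _ fun σ => ?_)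
    by_cases h1 : σ v = a <;> by_cases h2 : S.restrict σ ∈ t
    · have h2' : σ ∈ (fun (τ : V → A) (s : (S : Set V)) => τ s) ⁻¹' t := h2
      rw [Set.indicator_of_mem h2']
      simp [h1, h2]
    · have h2' : σ ∉ (fun (τ : V → A) (s : (S : Set V)) => τ s) ⁻¹' t := h2
      simp only [Set.indicator_of_notMem h2']
      simp [h2]
    · have h2' : σ ∈ (fun (τ : V → A) (s : (S : Set V)) => τ s) ⁻¹' t := h2
      rw [Set.indicator_of_mem h2']
      simp [h1]
    · have h2' : σ ∉ (fun (τ : V → A) (s : (S : Set V)) => τ s) ⁻¹' t := h2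
      simp only [Set.indicator_of_notMem h2']
      simp [h2]

theorem condEntropy_finset (v : V) (S : Finset V) :
    condEntropy μ v (S : Set V) =
      ∑ a, ∫ σ, Real.negMulLog (spinProb μ v S σ a) ∂μ := by
  rw [condEntropy_eq_sum]
  refine Finset.sum_congr rfl fun a _ => integral_congr_ae ?_
  filter_upwards [condExp_spin_ae_eq μ v a S] with σ hσ
  rw [hσ]

/-- The chain rule. -/
theorem condEntropy_eq_blockEntropy_sub [DecidableEq V] (v : V) (S : Finset V) :
    condEntropy μ v (S : Set V) = blockEntropy μ (insert v S) - blockEntropy μ S := by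
  classical
  let P : A → (S → A) → ℝ := fun a ζ => μ.real ({τ | τ v = a} ∩ spinCylinder S ζ)
  let Q : (S → A) → ℝ := fun ζ => μ.real (spinCylinder S ζ)
  have hPQ a ζ : P a ζ ≤ Q ζ := measureReal_mono Set.inter_subset_right
  have hP0 a ζ : 0 ≤ P a ζ := measureReal_nonneg
  have hpre a ζ : (fun τ : V → A => (τ v, S.restrict τ)) ⁻¹' {(a, ζ)} =
      {τ | τ v = a} ∩ spinCylinder S ζ := by
    ext τ; simp
  have h1 : condEntropy μ v (S : Set V) = ∑ a, ∑ ζ, Q ζ * Real.negMulLog (P a ζ / Q ζ) := by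
    rw [condEntropy_finset]
    refine Finset.sum_congr rfl fun a _ => ?_
    rw [← integral_comp_eq_sum μ (measurable_restrict S)
      (fun ζ => Real.negMulLog (P a ζ / Q ζ))]
    simp only [P, Q, restrict_preimage_singleton, spinProb]
  have h2 : blockEntropy μ (insert v S) = ∑ a, ∑ ζ, Real.negMulLog (P a ζ) := by
    have := integral_comp_eq_sum μ
      ((measurable_pi_apply v : Measurable fun τ : V → A => τ v).prodMk (measurable_restrict S))
      (fun k => Real.log (P k.1 k.2))
    rw [Fintype.sum_prod_type] at this
    simp only [hpre] at this
    have h3 (σ : V → A) : P (σ v) (S.restrict σ) = μ.real (agreeSet (insert v S) σ) := by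
      simp only [P, restrict_preimage_singleton]
      congr 1
      ext τ
      simp [agreeSet]
    simp only [h3] at this
    rw [blockEntropy_eq_integral, this, ← Finset.sum_neg_distrib]
    refine Finset.sum_congr rfl fun a _ => ?_
    rw [← Finset.sum_neg_distrib]
    exact Finset.sum_congr rfl fun ζ _ => by rw [Real.negMulLog, neg_mul]
  have h4 ζ : ∑ a, P a ζ = Q ζ := by
    simp only [P, Q]
    rw [← measureReal_biUnion_finset]
    · congr 1
      ext τ
      simp
    · intro a _ b _ hab
      refine Set.disjoint_left.2 fun τ h h' => hab ?_
      exact h.1.symm.trans h'.1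
    · exact fun a _ => (measurableSet_spin_eq v a).inter
        (measurable_restrict S (measurableSet_singleton ζ))
  have h5 : blockEntropy μ S = ∑ ζ, Real.negMulLog (Q ζ) := by
    rw [blockEntropy]
    congr!
  rw [h1, h2, h5, Finset.sum_comm, Finset.sum_comm (γ := A), ← Finset.sum_sub_distrib]
  refine Finset.sum_congr rfl fun ζ _ => ?_
  have h6 : Real.negMulLog (Q ζ) = ∑ a, -(P a ζ * Real.log (Q ζ)) := by
    rw [Finset.sum_neg_distrib, ← Finset.sum_mul, h4 ζ, Real.negMulLog, neg_mul]
  rw [eq_sub_iff_add_eq, h6, ← Finset.sum_add_distrib]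
  refine Finset.sum_congr rfl fun a _ => ?_
  rcases (hP0 a ζ).eq_or_lt with h | h
  · simp [← h]
  · have hQ : 0 < Q ζ := h.trans_le (hPQ a ζ)
    rw [Real.negMulLog, Real.negMulLog, Real.log_div h.ne' hQ.ne']
    field_simp
    ring

theorem blockEntropy_empty : blockEntropy μ ∅ = 0 := by
  have (σ : V → A) : agreeSet ∅ σ = Set.univ := by ext; simp [agreeSet]
  simp [blockEntropy_eq_integral, this]

theorem blockEntropy_univ [Fintype V] : blockEntropy μ Finset.univ = shannonEntropy μ := by
  classical
  have (σ : V → A) : agreeSet Finset.univ σ = {σ} := by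
    ext; simp [agreeSet, funext_iff]
  rw [blockEntropy_eq_integral, shannonEntropy]
  simp only [this]
  rw [integral_fintype .of_finite, ← Finset.sum_neg_distrib]
  refine Finset.sum_congr rfl fun σ _ => ?_
  rw [Real.negMulLog, smul_eq_mul, neg_mul]

/-- Pulled-back configurations agree on $S$ exactly when the original ones agree on $\varphi(S)$; no
injectivity of $\varphi$ is needed. -/
theorem blockEntropy_map [DecidableEq V] {W : Type*} (φ : W → V) (S : Finset W) :
    blockEntropy (μ.map fun σ g => σ (φ g)) S = blockEntropy μ (S.image φ) := by
  have hφ : Measurable fun (σ : V → A) (g : W) => σ (φ g) := by fun_prop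
  have := Measure.isProbabilityMeasure_map (μ := μ) hφ.aemeasurable
  rw [blockEntropy_eq_integral, blockEntropy_eq_integral, integral_map hφ.aemeasurable]
  · congr 1
    refine integral_congr_ae (ae_of_all _ fun σ => ?_)
    simp only
    rw [map_measureReal_apply hφ (measurableSet_agreeSet_pi _ _)]
    congr 2
    ext τ
    simp [agreeSet]
  · have : (fun σ : W → A => Real.log ((μ.map fun σ g => σ (φ g)).real (agreeSet S σ))) =
        (fun ζ : S → A => Real.log ((μ.map fun σ g => σ (φ g)).real (spinCylinder S ζ))) ∘
          S.restrict := by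
      funext σ
      simp only [Function.comp, restrict_preimage_singleton]
    rw [this]
    exact ((measurable_of_finite _).comp (measurable_restrict S)).aestronglyMeasurable

theorem condEntropy_map [DecidableEq V] {W : Type*} [DecidableEq W] (φ : W → V) (w : W)
    (S : Finset W) :
    condEntropy (μ.map fun σ g => σ (φ g)) w (S : Set W) =
      condEntropy μ (φ w) (S.image φ : Finset V) := by
  have hφ : Measurable fun (σ : V → A) (g : W) => σ (φ g) := by fun_prop
  have := Measure.isProbabilityMeasure_map (μ := μ) hφ.aemeasurable
  rw [condEntropy_eq_blockEntropy_sub, condEntropy_eq_blockEntropy_sub, blockEntropy_map,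
    blockEntropy_map, Finset.image_insert]

/-- If the conditional distribution of the spin at `v` given the spins in `T` hardly depends on the
spins in `T \ S`, then it is close to the conditional distribution given the spins in `S`. -/
theorem abs_spinProb_sub_le {v : V} {S T : Finset V} (hST : S ⊆ T) {a : A} {ε : ℝ}
    (h : ∀ σ τ : V → A, 0 < μ.real (agreeSet T σ) → 0 < μ.real (agreeSet T τ) →
      τ ∈ agreeSet S σ → |spinProb μ v T τ a - spinProb μ v T σ a| ≤ ε)
    {σ : V → A} (hσ : 0 < μ.real (agreeSet T σ)) :
    |spinProb μ v S σ a - spinProb μ v T σ a| ≤ ε := by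
  set E := agreeSet S σ with hE
  have hEm : MeasurableSet E := measurableSet_agreeSet_pi S σ
  have hpos : 0 < μ.real E := hσ.trans_le (measureReal_mono (agreeSet_anti hST σ))
  have hint : Integrable (fun τ => spinProb μ v T τ a) μ :=
    integrable_condExp.congr (condExp_spin_ae_eq μ v a T)
  -- $E$ is measurable with respect to the spins in $S \subseteq T$. Hence the probability given $S$
  -- is the average over $E$ of the probabilities given $T$, and these are nearly constant there.
  have h1 : ∫ τ in E, spinProb μ v T τ a ∂μ = μ.real ({τ | τ v = a} ∩ E) := by
    rw [← setIntegral_congr_ae (g := fun τ => spinProb μ v T τ a)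
      (f := μ⟦{τ : V → A | τ v = a} | spinSigma (T : Set V)⟧) hEm
      ((condExp_spin_ae_eq μ v a T).mono fun τ h _ => h),
      setIntegral_condExp (spinSigma_le _) (integrable_indicator_spin μ v a)
      (spinSigma_mono (Finset.coe_subset.2 hST) _ (measurableSet_agreeSet S σ)),
      setIntegral_indicator (measurableSet_spin_eq v a)]
    simp [Set.inter_comm, hE]
  have h2 : ‖∫ τ in E, (spinProb μ v T τ a - spinProb μ v T σ a) ∂μ‖ ≤ ε * μ.real E := by
    refine norm_setIntegral_le_of_norm_le_const_ae' (measure_lt_top _ _) ?_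
    filter_upwards [ae_agreeSet_pos μ T] with τ hτ hτE
    exact h σ τ hσ hτ hτE
  rw [integral_sub hint.integrableOn (integrable_const _), h1, setIntegral_const, smul_eq_mul,
    Real.norm_eq_abs] at h2
  have h3 : spinProb μ v S σ a - spinProb μ v T σ a =
      (μ.real ({τ | τ v = a} ∩ E) - μ.real E * spinProb μ v T σ a) / μ.real E := by
    rw [spinProb, ← hE]
    field_simp
  rw [h3, abs_div, abs_of_pos hpos, div_le_iff₀ hpos]
  exact h2

theorem condEntropy_le_add {v : V} {S T : Finset V} (hST : S ⊆ T) {ε ω : ℝ}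
    (hω : ∀ x ∈ Set.Icc (0 : ℝ) 1, ∀ y ∈ Set.Icc (0 : ℝ) 1, |x - y| ≤ ε →
      |Real.negMulLog x - Real.negMulLog y| ≤ ω)
    (h : ∀ a, ∀ σ τ : V → A, 0 < μ.real (agreeSet T σ) → 0 < μ.real (agreeSet T τ) →
      τ ∈ agreeSet S σ → |spinProb μ v T τ a - spinProb μ v T σ a| ≤ ε) :
    condEntropy μ v (S : Set V) ≤ condEntropy μ v (T : Set V) + Fintype.card A * ω := by
  have hint (R : Finset V) (a : A) :
      Integrable (fun σ => Real.negMulLog (spinProb μ v R σ a)) μ := by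
    refine (integrable_negMulLog_condExp μ v a (R : Set V)).congr ?_
    filter_upwards [condExp_spin_ae_eq μ v a R] with σ hσ
    rw [hσ]
  have key (a : A) : ∫ σ, Real.negMulLog (spinProb μ v S σ a) ∂μ ≤
      ∫ σ, Real.negMulLog (spinProb μ v T σ a) ∂μ + ω := by
    have h1 : ∫ σ, (Real.negMulLog (spinProb μ v T σ a) + ω) ∂μ =
        ∫ σ, Real.negMulLog (spinProb μ v T σ a) ∂μ + ω := by
      rw [integral_add (hint T a) (integrable_const _)]
      simp
    rw [← h1]
    refine integral_mono_ae (hint S a) ((hint T a).add (integrable_const _)) ?_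
    filter_upwards [ae_agreeSet_pos μ T] with σ hσ
    have h2 := hω _ (spinProb_mem_Icc μ v S σ a) _ (spinProb_mem_Icc μ v T σ a)
      (abs_spinProb_sub_le μ hST (h a) hσ)
    linarith [le_abs_self (Real.negMulLog (spinProb μ v S σ a) -
      Real.negMulLog (spinProb μ v T σ a))]
  rw [condEntropy_finset, condEntropy_finset]
  calc _ ≤ ∑ a, (∫ σ, Real.negMulLog (spinProb μ v T σ a) ∂μ + ω) :=
        Finset.sum_le_sum fun a _ => key a
    _ = _ := by simp [Finset.sum_add_distrib]

end finite

/-! ### Continuity of entropies in the local marginals -/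

section modulus

theorem exists_negMulLog_modulus {ω : ℝ} (hω : 0 < ω) : ∃ ε > 0, ∀ x ∈ Set.Icc (0 : ℝ) 1,
    ∀ y ∈ Set.Icc (0 : ℝ) 1, |x - y| ≤ ε → |Real.negMulLog x - Real.negMulLog y| ≤ ω := by
  have := isCompact_Icc.uniformContinuousOn_of_continuous
    (Real.continuous_negMulLog.continuousOn (s := Set.Icc (0 : ℝ) 1))
  obtain ⟨δ, hδ, h⟩ := Metric.uniformContinuousOn_iff.1 this ω hω
  refine ⟨δ / 2, half_pos hδ, fun x hx y hy hxy => ?_⟩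
  have := h x hx y hy (by rw [Real.dist_eq]; linarith)
  rw [Real.dist_eq] at this
  exact this.le

theorem abs_sub_le_tvDist {X : Type*} [MeasurableSpace X] (P Q : Measure X)
    [IsProbabilityMeasure P] [IsProbabilityMeasure Q] {s : Set X} (hs : MeasurableSet s) :
    |P.real s - Q.real s| ≤ tvDist P Q := by
  refine le_ciSup (f := fun s : {s : Set X // MeasurableSet s} => |P.real s - Q.real s|)
    ⟨1, ?_⟩ ⟨s, hs⟩
  rintro _ ⟨t, rfl⟩
  have := measureReal_le_one (μ := P) (s := (t : Set X))
  have := measureReal_le_one (μ := Q) (s := (t : Set X))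
  have := measureReal_nonneg (μ := P) (s := (t : Set X))
  have := measureReal_nonneg (μ := Q) (s := (t : Set X))
  exact abs_le.2 ⟨by linarith, by linarith⟩

/-- Entropies of the spins in subsets of `B` depend continuously on the marginal on `B`. -/
theorem exists_tvDist_blockEntropy {V A : Type*} [Fintype A] [MeasurableSpace A]
    [MeasurableSingletonClass A] (B : Finset V) {ε : ℝ} (hε : 0 < ε) :
    ∃ δ > 0, ∀ μ ν : Measure (V → A), ∀ [IsProbabilityMeasure μ] [IsProbabilityMeasure ν],
      tvDist (μ.map B.restrict) (ν.map B.restrict) ≤ δ → ∀ S ⊆ B,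
        |blockEntropy μ S - blockEntropy ν S| ≤ ε := by
  classical
  -- Dividing $\varepsilon$ by the number of cylinders over all subsets of $B$ gives one $\delta$
  -- for every $S \subseteq B$; the $+1$ keeps the denominator visibly positive.
  obtain ⟨δ, hδ, h⟩ := exists_negMulLog_modulus
    (ω := ε / (∑ S ∈ B.powerset, Fintype.card (S → A) + 1)) (by positivity)
  refine ⟨δ, hδ, fun μ ν _ _ hμν S hS => ?_⟩
  have hm := measurable_restrict (A := A) B
  have := Measure.isProbabilityMeasure_map (μ := μ) hm.aemeasurable
  have := Measure.isProbabilityMeasure_map (μ := ν) hm.aemeasurable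
  have key (ζ : S → A) : |Real.negMulLog (μ.real (spinCylinder S ζ)) -
      Real.negMulLog (ν.real (spinCylinder S ζ))| ≤
      ε / (∑ S ∈ B.powerset, Fintype.card (S → A) + 1) := by
    refine h _ ⟨measureReal_nonneg, measureReal_le_one⟩ _
      ⟨measureReal_nonneg, measureReal_le_one⟩ (le_trans ?_ hμν)
    have hpre : spinCylinder S ζ = B.restrict ⁻¹'
        {ξ : B → A | ∀ s : S, ξ ⟨s, hS s.2⟩ = ζ s} := by
      ext τ
      simp only [Set.mem_preimage, Set.mem_singleton_iff, funext_iff, Finset.restrict]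
      rfl
    rw [hpre, ← map_measureReal_apply hm .of_discrete, ← map_measureReal_apply hm .of_discrete]
    exact abs_sub_le_tvDist _ _ .of_discrete
  have hcard : (Fintype.card (S → A) : ℝ) ≤ ∑ S ∈ B.powerset, (Fintype.card (S → A) : ℝ) :=
    Finset.single_le_sum (f := fun S : Finset V => (Fintype.card (S → A) : ℝ))
      (fun _ _ => by positivity) (Finset.mem_powerset.2 hS)
  calc |blockEntropy μ S - blockEntropy ν S|
      = |∑ ζ : S → A, (Real.negMulLog (μ.real (spinCylinder S ζ)) -
          Real.negMulLog (ν.real (spinCylinder S ζ)))| := by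
        rw [Finset.sum_sub_distrib, blockEntropy, blockEntropy]
    _ ≤ ∑ ζ : S → A, ε / (∑ S ∈ B.powerset, Fintype.card (S → A) + 1) :=
        (Finset.abs_sum_le_sum_abs _ _).trans (Finset.sum_le_sum fun ζ _ => key ζ)
    _ = Fintype.card (S → A) * ε / (∑ S ∈ B.powerset, Fintype.card (S → A) + 1) := by
        rw [Finset.sum_const, nsmul_eq_mul, Finset.card_univ, mul_div_assoc]
    _ ≤ ε := by
        rw [div_le_iff₀ (by positivity)]
        push_cast
        nlinarith

/-- By the chain rule a conditional entropy is a difference of two block entropies, each controlled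
to within $\varepsilon/2$. -/
theorem exists_tvDist_condEntropy {V A : Type*} [DecidableEq V] [Fintype A] [MeasurableSpace A]
    [MeasurableSingletonClass A] (B : Finset V) {ε : ℝ} (hε : 0 < ε) :
    ∃ δ > 0, ∀ μ ν : Measure (V → A), ∀ [IsProbabilityMeasure μ] [IsProbabilityMeasure ν],
      tvDist (μ.map B.restrict) (ν.map B.restrict) ≤ δ → ∀ v ∈ B, ∀ S ⊆ B,
        |condEntropy μ v (S : Set V) - condEntropy ν v (S : Set V)| ≤ ε := by
  obtain ⟨δ, hδ, h⟩ := exists_tvDist_blockEntropy (A := A) B (half_pos hε)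
  refine ⟨δ, hδ, fun μ ν _ _ hμν v hv S hS => ?_⟩
  have h1 := abs_le.1 (h μ ν hμν S hS)
  have h2 := abs_le.1 (h μ ν hμν (insert v S) (Finset.insert_subset hv hS))
  rw [condEntropy_eq_blockEntropy_sub, condEntropy_eq_blockEntropy_sub, abs_le]
  constructor <;> linarith [h1.1, h1.2, h2.1, h2.2]

end modulus

/-! ### Averages over Bernoulli random subsets of a finite set -/

section bernoulli

variable {V : Type*} [DecidableEq V]

/-- The expectation of `f` at a random subset of `B` containing each element independently with
probability `p`. -/
def bernAvg (p : ℝ) (B : Finset V) (f : Finset V → ℝ) : ℝ :=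
  ∑ S ∈ B.powerset, p ^ S.card * (1 - p) ^ (B \ S).card * f S

/-- Condition on whether $x$ belongs to the random set. This recursion drives the inductions on the
ground set below. -/
theorem bernAvg_insert (p : ℝ) {B : Finset V} {x : V} (hx : x ∉ B) (f : Finset V → ℝ) :
    bernAvg p (insert x B) f =
      (1 - p) * bernAvg p B f + p * bernAvg p B fun S => f (insert x S) := by
  rw [bernAvg, Finset.sum_powerset_insert hx, bernAvg, bernAvg, Finset.mul_sum, Finset.mul_sum]
  congr 1
  · refine Finset.sum_congr rfl fun S hS => ?_
    have hxS : x ∉ S := fun h => hx (Finset.mem_powerset.1 hS h)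
    rw [Finset.insert_sdiff_of_notMem _ hxS, Finset.card_insert_of_notMem (by simp [hx])]
    ring
  · refine Finset.sum_congr rfl fun S hS => ?_
    have hxS : x ∉ S := fun h => hx (Finset.mem_powerset.1 hS h)
    have : insert x B \ insert x S = B \ S := by
      ext y; simp only [Finset.mem_sdiff, Finset.mem_insert]; grind
    rw [this, Finset.card_insert_of_notMem hxS]
    ring

theorem bernAvg_congr (p : ℝ) {B : Finset V} {f g : Finset V → ℝ} (h : ∀ S ⊆ B, f S = g S) :
    bernAvg p B f = bernAvg p B g :=
  Finset.sum_congr rfl fun S hS => by rw [h S (Finset.mem_powerset.1 hS)]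

theorem bernAvg_mono {p : ℝ} (hp : p ∈ Set.Icc (0 : ℝ) 1) {B : Finset V} {f g : Finset V → ℝ}
    (h : ∀ S ⊆ B, f S ≤ g S) : bernAvg p B f ≤ bernAvg p B g := by
  refine Finset.sum_le_sum fun S hS => mul_le_mul_of_nonneg_left (h S (Finset.mem_powerset.1 hS)) ?_
  have := hp.1
  have : 0 ≤ 1 - p := by linarith [hp.2]
  positivity

theorem bernAvg_const (p : ℝ) (B : Finset V) (c : ℝ) : bernAvg p B (fun _ => c) = c := by
  induction B using Finset.induction_on with
  | empty => simp [bernAvg]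
  | insert x B hx ih => rw [bernAvg_insert p hx, ih]; ring

theorem bernAvg_add (p : ℝ) (B : Finset V) (f g : Finset V → ℝ) :
    bernAvg p B (fun S => f S + g S) = bernAvg p B f + bernAvg p B g := by
  simp only [bernAvg, mul_add, Finset.sum_add_distrib]

theorem bernAvg_sub (p : ℝ) (B : Finset V) (f g : Finset V → ℝ) :
    bernAvg p B (fun S => f S - g S) = bernAvg p B f - bernAvg p B g := by
  simp only [bernAvg, mul_sub, Finset.sum_sub_distrib]

theorem continuous_bernAvg (B : Finset V) (f : Finset V → ℝ) :
    Continuous fun p => bernAvg p B f := by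
  unfold bernAvg
  fun_prop

/-- The intersection of a random subset with `B` is a random subset of `B`. -/
theorem bernAvg_inter (p : ℝ) {B C : Finset V} (hBC : B ⊆ C) (f : Finset V → ℝ) :
    bernAvg p C (fun S => f (S ∩ B)) = bernAvg p B f := by
  obtain ⟨D, hD, rfl⟩ : ∃ D, Disjoint D B ∧ D ∪ B = C :=
    ⟨C \ B, Finset.sdiff_disjoint, Finset.sdiff_union_of_subset hBC⟩
  clear hBC
  induction D using Finset.induction_on with
  | empty =>
    rw [Finset.empty_union]
    exact bernAvg_congr p fun S hS => by rw [Finset.inter_eq_left.2 hS]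
  | insert x D hx ih =>
    rw [Finset.disjoint_insert_left] at hD
    rw [Finset.insert_union, bernAvg_insert p (by simp [hx, hD.1])]
    simp only [Finset.insert_inter_of_notMem hD.1]
    rw [ih hD.2]
    ring

theorem bernAvg_image {W : Type*} [DecidableEq W] (p : ℝ) {φ : W → V} {B : Finset W}
    (hφ : Set.InjOn φ B) (f : Finset V → ℝ) :
    bernAvg p (B.image φ) f = bernAvg p B fun S => f (S.image φ) := by
  induction B using Finset.induction_on generalizing f with
  | empty => simp [bernAvg]
  | insert x B hx ih =>
    rw [Finset.coe_insert, Set.injOn_insert (by simpa using hx)] at hφ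
    have hx' : φ x ∉ B.image φ := by
      intro h
      obtain ⟨y, hy, hxy⟩ := Finset.mem_image.1 h
      exact hφ.2 ⟨y, hy, hxy⟩
    rw [Finset.image_insert, bernAvg_insert p hx', bernAvg_insert p hx, ih hφ.1, ih hφ.1]
    simp only [Finset.image_insert]

/-- Russo's formula. -/
theorem hasDerivAt_bernAvg (p : ℝ) (B : Finset V) (f : Finset V → ℝ) :
    HasDerivAt (fun q => bernAvg q B f)
      (∑ v ∈ B, bernAvg p B fun S => f (insert v S) - f (S.erase v)) p := by
  induction B using Finset.induction_on generalizing f with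
  | empty => simpa [bernAvg] using hasDerivAt_const p (f ∅)
  | insert x B hx ih =>
    -- Product rule in the recursion for `insert x B`: differentiating the factors $1-p$ and $p$
    -- yields the increment at $x$; the induction hypothesis yields those at the points of $B$.
    have h := ((hasDerivAt_const p (1 : ℝ)).sub (hasDerivAt_id p)).mul (ih f) |>.add
      ((hasDerivAt_id p).mul (ih fun S => f (insert x S)))
    have hfun : (fun q => bernAvg q (insert x B) f) =
        (fun q => (1 - q) * bernAvg q B f + q * bernAvg q B fun S => f (insert x S)) := by
      funext q
      exact bernAvg_insert q hx f
    rw [hfun]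
    refine HasDerivAt.congr_deriv (f' := _) h ?_
    rw [Finset.sum_insert hx, bernAvg_insert p hx]
    have h1 : (bernAvg p B fun S => f (insert x S) - f (S.erase x)) =
        bernAvg p B (fun S => f (insert x S)) - bernAvg p B f := by
      rw [← bernAvg_sub]
      refine bernAvg_congr p fun S hS => ?_
      rw [Finset.erase_eq_of_notMem fun h => hx (hS h)]
    have h2 : (bernAvg p B fun S => f (insert x (insert x S)) - f ((insert x S).erase x)) =
        bernAvg p B (fun S => f (insert x S)) - bernAvg p B f := by
      rw [← bernAvg_sub]
      refine bernAvg_congr p fun S hS => ?_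
      rw [Finset.erase_insert fun h => hx (hS h), Finset.insert_idem]
    have h3 : ∀ v ∈ B, (bernAvg p (insert x B) fun S => f (insert v S) - f (S.erase v)) =
        (1 - p) * (bernAvg p B fun S => f (insert v S) - f (S.erase v)) +
        p * (bernAvg p B fun S => f (insert x (insert v S)) - f (insert x (S.erase v))) := by
      intro v hv
      rw [bernAvg_insert p hx]
      congr 2
      refine bernAvg_congr p fun S _ => ?_
      have hvx : v ≠ x := fun h => hx (h ▸ hv)
      rw [Finset.insert_comm, Finset.erase_insert_of_ne hvx.symm]
    rw [h1, h2, Finset.sum_congr rfl h3, Finset.sum_add_distrib, ← Finset.mul_sum,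
      ← Finset.mul_sum]
    simp only [Pi.sub_apply, id]
    ring

/-- Russo's formula integrated from $p=0$, where the random set is empty, to $p=1$, where it is all
of $B$. -/
theorem sub_eq_integral_bernAvg (B : Finset V) (f : Finset V → ℝ) :
    f B - f ∅ = ∑ v ∈ B, ∫ p in (0 : ℝ)..1,
      bernAvg p B fun S => f (insert v S) - f (S.erase v) := by
  have h0 : bernAvg 0 B f = f ∅ := by
    rw [bernAvg, Finset.sum_eq_single ∅]
    · simp
    · intro S _ hS
      simp [hS]
    · simp
  have h1 : bernAvg 1 B f = f B := by
    rw [bernAvg, Finset.sum_eq_single B]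
    · simp
    · intro S hS hSB
      have : (B \ S).card ≠ 0 := by
        rw [Finset.card_ne_zero, Finset.sdiff_nonempty]
        exact fun h => hSB (Finset.Subset.antisymm (Finset.mem_powerset.1 hS) h)
      simp [this]
    · simp
  rw [← h0, ← h1, ← intervalIntegral.integral_finsetSum fun v _ =>
    (continuous_bernAvg B _).intervalIntegrable 0 1]
  refine (intervalIntegral.integral_eq_sub_of_hasDerivAt
    (fun p _ => hasDerivAt_bernAvg p B f) ?_).symm
  exact (continuous_finsetSum _ fun v _ => continuous_bernAvg B _).intervalIntegrable 0 1

theorem integral_unitInterval (g : ℝ → ℝ) :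
    ∫ p : unitInterval, g p = ∫ p in (0 : ℝ)..1, g p := by
  rw [intervalIntegral.integral_of_le zero_le_one, ← integral_Icc_eq_integral_Ioc]
  exact integral_subtype measurableSet_Icc g

theorem measurableSet_forall_mem_iff (B T : Finset V) :
    MeasurableSet {S : Set V | ∀ i ∈ B, i ∈ S ↔ i ∈ T} := by
  have h : {S : Set V | ∀ i ∈ B, i ∈ S ↔ i ∈ T} = ⋂ i ∈ B, {S | i ∈ S ↔ i ∈ T} := by
    ext S; simp
  rw [h]
  refine Finset.measurableSet_biInter B fun i _ => ?_
  by_cases hi : i ∈ T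
  · simpa [hi] using measurableSet_setOfPred.2 (measurable_set_mem i)
  · simpa [hi] using measurableSet_setOfPred.2 (measurable_set_notMem i)

/-- The event is a cylinder of the product measure, with factor $p$ at points of $T$ and $1-p$ at
the other points of $B$. -/
theorem setBernoulli_real_forall_mem_iff (p : unitInterval) {B T : Finset V} (hT : T ⊆ B) :
    (setBernoulli (Set.univ : Set V) p).real {S : Set V | ∀ i ∈ B, i ∈ S ↔ i ∈ T} =
      (p : ℝ) ^ T.card * (1 - p : ℝ) ^ (B \ T).card := by
  classical
  have h : (fun q : V → Prop => {i | q i}) ⁻¹' {S : Set V | ∀ i ∈ B, i ∈ S ↔ i ∈ T} =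
      Set.pi B fun i => {q : Prop | q ↔ i ∈ T} := by
    ext q
    simp [Set.mem_pi]
  rw [measureReal_def, setBernoulli_apply', h, Measure.infinitePi_pi _ fun _ _ => .of_discrete,
    ENNReal.toReal_prod]
  have h2 : ∀ i ∈ B, ((unitInterval.toNNReal p • Measure.dirac (i ∈ (Set.univ : Set V)) +
      unitInterval.toNNReal (unitInterval.symm p) • Measure.dirac False) {q : Prop | q ↔ i ∈ T}).toReal =
      if i ∈ T then (p : ℝ) else 1 - p := by
    intro i _
    by_cases hi : i ∈ T <;> simp [hi]
  rw [Finset.prod_congr rfl h2, Finset.prod_ite, Finset.prod_const, Finset.prod_const,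
    Finset.filter_mem_eq_inter, Finset.inter_eq_right.2 hT, Finset.filter_notMem_eq_sdiff]

/-- $S \cap B$ takes finitely many values, so $f(S\cap B)$ is a finite combination of indicators of
cylinders. Hence no measurability of $f$ is required. -/
theorem apply_inter_eq_sum_indicator {W : Type*} (B : Finset W) (f : Set W → ℝ) (S : Set W) :
    f (S ∩ B) = ∑ T ∈ B.powerset,
      {S : Set W | ∀ i ∈ B, i ∈ S ↔ i ∈ T}.indicator (fun _ => f (T : Set W)) S := by
  classical
  have hmem : B.filter (· ∈ S) ∈ B.powerset := Finset.mem_powerset.2 (Finset.filter_subset _ _)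
  rw [Finset.sum_eq_single_of_mem _ hmem]
  · rw [Set.indicator_of_mem]
    · congr 1
      ext i
      simp [and_comm]
    · intro i hi
      simp [hi]
  · intro T hT hne
    refine Set.indicator_of_notMem (fun hS => hne ?_) _
    ext i
    rw [Finset.mem_filter]
    exact ⟨fun hi => ⟨Finset.mem_powerset.1 hT hi, (hS i (Finset.mem_powerset.1 hT hi)).2 hi⟩,
      fun hi => (hS i hi.1).1 hi.2⟩

/-- The law of the intersection of a Bernoulli random set with a finite set. -/
theorem integral_setBernoulli_inter (p : unitInterval) (B : Finset V) (f : Set V → ℝ) :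
    ∫ S, f (S ∩ B) ∂(setBernoulli (Set.univ : Set V) p) =
      bernAvg p B fun S => f (S : Set V) := by
  simp only [apply_inter_eq_sum_indicator B f]
  rw [integral_finsetSum _ fun T _ =>
    (integrable_const _).indicator (measurableSet_forall_mem_iff B T), bernAvg]
  refine Finset.sum_congr rfl fun T hT => ?_
  rw [integral_indicator_const _ (measurableSet_forall_mem_iff B T), smul_eq_mul,
    setBernoulli_real_forall_mem_iff p (Finset.mem_powerset.1 hT)]

theorem measurable_inter_finset (B : Finset V) (f : Set V → ℝ) :
    Measurable fun S : Set V => f (S ∩ B) := by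
  simp only [apply_inter_eq_sum_indicator B f]
  exact Finset.measurable_fun_sum _ fun T _ =>
    measurable_const.indicator (measurableSet_forall_mem_iff B T)

end bernoulli

/-! ### Balls of the tree -/

section tree

variable {κ : Labelling} {m : ℕ}

theorem mem_treeBall {r : ℕ} {g : TreeGroup κ m} :
    g ∈ treeBall κ m r ↔ (cayleyTree κ m).edist 1 g ≤ r := by
  simp [treeBall, closedBall]

theorem one_mem_treeBall (r : ℕ) : (1 : TreeGroup κ m) ∈ treeBall κ m r := by
  simp [mem_treeBall]

theorem treeBall_mono : Monotone (treeBall κ m) := fun _ _ h _ hg =>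
  mem_treeBall.2 ((mem_treeBall.1 hg).trans (by exact_mod_cast h))

theorem edist_mul_gen_le (g : TreeGroup κ m) (i : Fin m) :
    (cayleyTree κ m).edist g (g * gen κ i) ≤ 1 := by
  rw [SimpleGraph.edist_le_one_iff_adj_or_eq]
  by_cases h : g = g * gen κ i
  · exact Or.inr h
  · exact Or.inl ⟨h, Or.inl ⟨i, rfl⟩⟩

theorem edist_mul_gen_inv_le (g : TreeGroup κ m) (i : Fin m) :
    (cayleyTree κ m).edist g (g * (gen κ i)⁻¹) ≤ 1 := by
  rw [SimpleGraph.edist_comm]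
  simpa using edist_mul_gen_le (g * (gen κ i)⁻¹) i

theorem mem_treeBall_succ_of_edist_le {r : ℕ} {g h : TreeGroup κ m} (hg : g ∈ treeBall κ m r)
    (hgh : (cayleyTree κ m).edist g h ≤ 1) : h ∈ treeBall κ m (r + 1) := by
  rw [mem_treeBall] at *
  push_cast
  exact SimpleGraph.edist_triangle.trans (add_le_add hg hgh)

/-- Connectedness of the Cayley graph, by induction over products of generators and their inverses.
-/
theorem exists_mem_treeBall (g : TreeGroup κ m) : ∃ r, g ∈ treeBall κ m r := by
  have hg : g ∈ Subgroup.closure (Set.range (PresentedGroup.of (rels := κ.relators m))) := by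
    rw [PresentedGroup.closure_range_of]
    trivial
  induction hg using Subgroup.closure_induction_right with
  | one => exact ⟨0, one_mem_treeBall 0⟩
  | mul_right x _ y hy ih =>
    obtain ⟨⟨i, rfl⟩, r, hr⟩ := hy, ih
    exact ⟨r + 1, mem_treeBall_succ_of_edist_le hr (edist_mul_gen_le x i)⟩
  | mul_inv_cancel x _ y hy ih =>
    obtain ⟨⟨i, rfl⟩, r, hr⟩ := hy, ih
    exact ⟨r + 1, mem_treeBall_succ_of_edist_le hr (edist_mul_gen_inv_le x i)⟩

theorem exists_subset_treeBall (D : Finset (TreeGroup κ m)) : ∃ r, D ⊆ treeBall κ m r := by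
  classical
  choose r hr using exists_mem_treeBall (κ := κ) (m := m)
  exact ⟨D.sup r, fun g hg => treeBall_mono (Finset.le_sup hg) (hr g)⟩

theorem iUnion_treeBall : ⋃ r, (treeBall κ m r : Set (TreeGroup κ m)) = Set.univ :=
  Set.eq_univ_of_forall fun g => Set.mem_iUnion.2 (exists_mem_treeBall g)

variable {A : Type*} [Fintype A] [MeasurableSpace A] [MeasurableSingletonClass A]

/-- The average of the conditional entropy of the spin at the root, given the spins in a Bernoulli
random subset of a finite set. -/
def localPercolativeEntropy (μ : Measure (TreeGroup κ m → A)) (B : Finset (TreeGroup κ m)) : ℝ :=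
  open scoped Classical in
  ∫ p in (0 : ℝ)..1, bernAvg p B fun S => condEntropy μ 1 (S.erase 1 : Finset (TreeGroup κ m))

/-- The sets $S \cap T_d(r)$ increase to $S$, so the conditional entropies converge for each fixed
$S$. Dominated convergence with bound $|A|$ is then applied over $S$ and over $p$. -/
theorem tendsto_localPercolativeEntropy (μ : Measure (TreeGroup κ m → A))
    [IsProbabilityMeasure μ] :
    Tendsto (fun r => localPercolativeEntropy μ (treeBall κ m r)) atTop
      (𝓝 (percolativeEntropy μ)) := by
  classical
  let f : Set (TreeGroup κ m) → ℝ := fun S => condEntropy μ 1 (S \ {1})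
  have hf (S) : ‖f S‖ ≤ Fintype.card A := by
    rw [Real.norm_eq_abs, abs_of_nonneg (condEntropy_nonneg μ 1 _)]
    exact condEntropy_le μ 1 _
  have h1 (r : ℕ) : localPercolativeEntropy μ (treeBall κ m r) = ∫ p : unitInterval,
      ∫ S, f (S ∩ treeBall κ m r) ∂(setBernoulli (Set.univ : Set (TreeGroup κ m)) p) := by
    simp only [integral_setBernoulli_inter]
    rw [localPercolativeEntropy, integral_unitInterval
      (fun p => bernAvg p (treeBall κ m r) fun S => f S)]
    simp only [f, Finset.coe_erase]
  simp only [h1]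
  refine tendsto_integral_of_dominated_convergence (fun _ => (Fintype.card A : ℝ))
    (fun r => ?_) (integrable_const _) (fun r => ae_of_all _ fun p => ?_)
    (ae_of_all _ fun p => ?_)
  · simp only [integral_setBernoulli_inter]
    exact ((continuous_bernAvg _ _).comp continuous_subtype_val).aestronglyMeasurable
  · refine (norm_integral_le_of_norm_le_const (ae_of_all _ fun S => hf _)).trans ?_
    simp
  · refine tendsto_integral_of_dominated_convergence (fun _ => (Fintype.card A : ℝ))
      (fun r => (measurable_inter_finset _ f).aestronglyMeasurable) (integrable_const _)
      (fun r => ae_of_all _ fun S => hf _) (ae_of_all _ fun S => ?_)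
    have := tendsto_condEntropy_iUnion μ 1
      (S := fun r => (S ∩ treeBall κ m r) \ {(1 : TreeGroup κ m)})
      (fun r s hrs => Set.sdiff_subset_sdiff_left
        (Set.inter_subset_inter_right _ (Finset.coe_subset.2 (treeBall_mono hrs))))
    rwa [← Set.iUnion_sdiff, ← Set.inter_iUnion, iUnion_treeBall, Set.inter_univ] at this

end tree

/-! ### Covering a finite labelled graph by the tree -/

namespace LabelledGraph

variable {κ : Labelling} {m : ℕ} {V : Type*} (G : LabelledGraph κ m V)

@[simp]
theorem act_one (v : V) : G.act 1 v = v := by simp [act]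

theorem act_mul (g h : TreeGroup κ m) (v : V) : G.act (g * h) v = G.act h (G.act g v) := by
  simp [act]

theorem act_inv_act (g : TreeGroup κ m) (v : V) : G.act g⁻¹ (G.act g v) = v := by
  rw [← act_mul, mul_inv_cancel, act_one]

theorem pullback_mul {A : Type*} (g : TreeGroup κ m) (v : V) (σ : V → A) :
    (fun h => G.pullback v σ (g * h)) = G.pullback (G.act g v) σ := by
  funext h
  simp [pullback, act_mul]

/-- Walks lift to the tree edge by edge: an edge traversed along its direction multiplies by $s_i$,
against it by $s_i^{-1}$. -/
theorem exists_act_eq_of_walk {v u : V} (p : G.graph.Walk v u) :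
    ∃ g ∈ treeBall κ m p.length, G.act g v = u := by
  induction p using SimpleGraph.Walk.concatRec with
  | Hnil => exact ⟨1, one_mem_treeBall _, G.act_one _⟩
  | Hconcat p h ih =>
    obtain ⟨g, hg, rfl⟩ := ih
    rw [SimpleGraph.Walk.length_concat]
    obtain ⟨-, ⟨i, hi⟩ | ⟨i, hi⟩⟩ := h
    · exact ⟨g * gen κ i, mem_treeBall_succ_of_edist_le hg (edist_mul_gen_le g i), by
        rw [act_mul_gen, hi]⟩
    · refine ⟨g * (gen κ i)⁻¹, mem_treeBall_succ_of_edist_le hg (edist_mul_gen_inv_le g i), ?_⟩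
      refine (G.perm i).injective ?_
      rw [← act_mul_gen, inv_mul_cancel_right, hi]

/-- If the ball of radius `t` about `v` is a tree, then the covering is injective on the ball. -/
theorem injOn_act_of_iso [Finite V] {v : V} {t : ℕ}
    (e : Nonempty (G.graph.induce (closedBall G.graph v t) ≃g
      (cayleyTree κ m).induce (closedBall (cayleyTree κ m) 1 t))) :
    Set.InjOn (fun g => G.act g v) (treeBall κ m t) := by
  classical
  have := Fintype.ofFinite V
  obtain ⟨e⟩ := e
  have hcoe : (treeBall κ m t : Set (TreeGroup κ m)) = closedBall (cayleyTree κ m) 1 t := by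
    ext g; simp [mem_treeBall, closedBall]
  -- Only the cardinality is taken from the isomorphism, which need respect neither root nor labels.
  -- The covering sends $T_d(t)$ onto a set containing the equally large $B(v,t)$, so it cannot
  -- identify two points.
  have hcard : (closedBall G.graph v t).ncard = (treeBall κ m t).card := by
    rw [← Set.ncard_coe_finset, hcoe]
    exact Nat.card_congr e.toEquiv
  have hsub : closedBall G.graph v t ⊆ ((treeBall κ m t).image fun g => G.act g v : Finset V) := by
    intro u hu
    have hu' : G.graph.edist v u ≤ t := hu
    obtain ⟨p, hp⟩ := SimpleGraph.exists_walk_of_edist_ne_top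
      (ne_top_of_le_ne_top (ENat.natCast_ne_top _) hu')
    rw [← hp] at hu'
    obtain ⟨g, hg, rfl⟩ := G.exists_act_eq_of_walk p
    exact Finset.mem_coe.2 (Finset.mem_image_of_mem _
      (treeBall_mono (by exact_mod_cast hu') hg))
  rw [← Finset.card_image_iff]
  refine le_antisymm Finset.card_image_le ?_
  rw [← hcard, ← Set.ncard_coe_finset]
  exact Set.ncard_le_ncard hsub (Finset.finite_toSet _)

end LabelledGraph

/-! ### Uniform vertices -/

section uniform

variable {V : Type*} [Fintype V]

open scoped Classical in
theorem uniformProb_eq_card_filter (P : V → Prop) :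
    uniformProb P = ((Finset.univ.filter P).card : ℝ) / Fintype.card V := by
  rw [uniformProb, Nat.card_eq_fintype_card, Nat.card_eq_fintype_card, Fintype.card_subtype]

theorem uniformProb_nonneg {W : Type*} (P : W → Prop) : 0 ≤ uniformProb P := by
  unfold uniformProb; positivity

theorem uniformProb_mono {P Q : V → Prop} (h : ∀ v, P v → Q v) : uniformProb P ≤ uniformProb Q := by
  classical
  rw [uniformProb_eq_card_filter, uniformProb_eq_card_filter]
  gcongr with v
  exact h v

theorem uniformProb_or_le (P Q : V → Prop) :
    uniformProb (fun v => P v ∨ Q v) ≤ uniformProb P + uniformProb Q := by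
  classical
  rw [uniformProb_eq_card_filter, uniformProb_eq_card_filter, uniformProb_eq_card_filter,
    ← add_div]
  gcongr
  norm_cast
  refine (Finset.card_le_card fun v hv => ?_).trans (Finset.card_union_le _ _)
  simpa using hv

theorem uniformProb_not [Nonempty V] (P : V → Prop) :
    uniformProb (fun v => ¬ P v) = 1 - uniformProb P := by
  classical
  rw [uniformProb_eq_card_filter, uniformProb_eq_card_filter, eq_sub_iff_add_eq, ← add_div,
    div_eq_one_iff_eq (by positivity)]
  have := Finset.card_filter_add_card_filter_not (s := Finset.univ) P
  rw [Finset.card_univ] at this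
  rw [← this, add_comm]
  norm_cast
  congr!

/-- An average is close to a constant that bounds most of its terms. -/
theorem sum_div_card_le [Nonempty V] {f : V → ℝ} {bad : V → Prop} {c M : ℝ}
    (h1 : ∀ v, ¬ bad v → f v ≤ c) (h2 : ∀ v, f v ≤ c + M) :
    (∑ v, f v) / Fintype.card V ≤ c + M * uniformProb bad := by
  classical
  have h : ∀ v ∈ Finset.univ, f v ≤ c + if bad v then M else 0 := by
    intro v _
    by_cases hv : bad v
    · simpa [hv] using h2 v
    · simpa [hv] using h1 v hv
  rw [uniformProb_eq_card_filter, div_le_iff₀ (by positivity)]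
  refine (Finset.sum_le_sum h).trans (le_of_eq ?_)
  rw [Finset.sum_add_distrib, Finset.sum_ite]
  simp
  field_simp

theorem le_sum_div_card [Nonempty V] {f : V → ℝ} {bad : V → Prop} {c M : ℝ}
    (h1 : ∀ v, ¬ bad v → c ≤ f v) (h2 : ∀ v, c - M ≤ f v) :
    c - M * uniformProb bad ≤ (∑ v, f v) / Fintype.card V := by
  have := sum_div_card_le (f := fun v => -f v) (bad := bad) (c := -c) (M := M)
    (fun v hv => neg_le_neg (h1 v hv)) (fun v => by linarith [h2 v])
  rw [Finset.sum_neg_distrib, neg_div] at this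
  linarith

end uniform

theorem tendsto_uniformProb_not_injOn {κ : Labelling} {m : ℕ} {V : ℕ → Type*}
    [∀ n, Fintype (V n)] [∀ n, Nonempty (V n)] {G : ∀ n, LabelledGraph κ m (V n)}
    (hG : LocallyConverges G) (D : Finset (TreeGroup κ m)) :
    Tendsto (fun n => uniformProb fun v : V n => ¬ Set.InjOn (fun g => (G n).act g v) D)
      atTop (𝓝 0) := by
  obtain ⟨t, ht⟩ := exists_subset_treeBall D
  have h := (hG t).const_sub 1
  simp only [sub_self] at h
  refine tendsto_of_tendsto_of_tendsto_of_le_of_le tendsto_const_nhds h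
    (fun n => uniformProb_nonneg _) fun n => ?_
  simp only
  rw [← uniformProb_not]
  exact uniformProb_mono fun v hv he =>
    hv (((G n).injOn_act_of_iso he).mono (Finset.coe_subset.2 ht))

/-! ### Boltzmann weights -/

section expBot

@[simp] theorem expBot_bot : expBot ⊥ = 0 := rfl

@[simp] theorem expBot_coe (x : ℝ) : expBot x = Real.exp x := rfl

theorem expBot_nonneg (x : WithBot ℝ) : 0 ≤ expBot x := by
  induction x using WithBot.recBotCoe with
  | bot => exact le_rfl
  | coe x => exact (Real.exp_pos x).le

theorem expBot_ne_zero_iff {x : WithBot ℝ} : expBot x ≠ 0 ↔ x ≠ ⊥ := by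
  induction x using WithBot.recBotCoe with
  | bot => simp
  | coe x => simp [Real.exp_ne_zero]

theorem expBot_add (x y : WithBot ℝ) : expBot (x + y) = expBot x * expBot y := by
  induction x using WithBot.recBotCoe with
  | bot => simp
  | coe x =>
    induction y using WithBot.recBotCoe with
    | bot => simp
    | coe y => rw [← WithBot.coe_add, expBot_coe, expBot_coe, expBot_coe, Real.exp_add]

theorem expBot_sum {ι : Type*} (s : Finset ι) (f : ι → WithBot ℝ) :
    expBot (∑ i ∈ s, f i) = ∏ i ∈ s, expBot (f i) := by
  classical
  induction s using Finset.induction_on with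
  | empty => exact Real.exp_zero
  | insert i s hi ih => rw [Finset.sum_insert hi, Finset.prod_insert hi, expBot_add, ih]

/-- With $k$ the order of a stabilizer: a set in the family arises from $k$ translations, each
carrying $1/k$ of its energy. -/
theorem expBot_map_div_pow (x : WithBot ℝ) {k : ℕ} (hk : k ≠ 0) :
    expBot (x.map fun y => y / k) ^ k = expBot x := by
  induction x using WithBot.recBotCoe with
  | bot => simp [hk]
  | coe x =>
    rw [WithBot.map_coe, expBot_coe, expBot_coe, ← Real.exp_nat_mul]
    congr 1
    field_simp

end expBot

/-! ### Factorization of Boltzmann weights near a vertex -/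

namespace Interaction

variable {κ : Labelling} {m : ℕ}

theorem mem_translate {g b : TreeGroup κ m} {F : Finset (TreeGroup κ m)} :
    b ∈ translate g F ↔ ∃ f ∈ F, g * f = b := by
  simp [translate]

theorem translate_mul (g h : TreeGroup κ m) (F : Finset (TreeGroup κ m)) :
    translate (g * h) F = translate g (translate h F) := by
  ext b
  simp [mem_translate, mul_assoc]

theorem translate_one (F : Finset (TreeGroup κ m)) : translate 1 F = F := by
  ext b
  simp [mem_translate]

variable {A : Type*} (Φ : Interaction (TreeGroup κ m) A) (T : Finset (Finset (TreeGroup κ m)))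

/-- The Boltzmann factor of the interaction at the image of `F` under the covering based at `w`. -/
def term {V : Type*} (G : LabelledGraph κ m V) (w : V) (F : Finset (TreeGroup κ m))
    (σ : V → A) : ℝ :=
  expBot ((Φ.val F (F.restrict (G.pullback w σ))).map fun x : ℝ => x / stabilizerCard F)

/-- The Boltzmann weight of a configuration on a finite labelled graph. -/
def boltzmann {V : Type*} [Fintype V] (G : LabelledGraph κ m V) (σ : V → A) : ℝ :=
  expBot (Φ.hamiltonian T G σ)

theorem boltzmann_nonneg {V : Type*} [Fintype V] (G : LabelledGraph κ m V) (σ : V → A) :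
    0 ≤ Φ.boltzmann T G σ := expBot_nonneg _

theorem boltzmann_eq_prod {V : Type*} [Fintype V] (G : LabelledGraph κ m V) (σ : V → A) :
    Φ.boltzmann T G σ = ∏ q ∈ Finset.univ ×ˢ T, Φ.term G q.1 q.2 σ := by
  rw [boltzmann, hamiltonian, expBot_sum, Finset.prod_product]
  exact Finset.prod_congr rfl fun w _ => expBot_sum _ _

variable {Φ T}

/-- Configurations of positive weight lift to admissible configurations. -/
theorem pullback_mem_admissible (hinv : Φ.IsTranslationInvariant) (hT : Φ.IsTransversal T)
    {V : Type*} [Fintype V] {G : LabelledGraph κ m V} {σ : V → A}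
    (hσ : Φ.boltzmann T G σ ≠ 0) (v : V) : G.pullback v σ ∈ Φ.admissible := by
  intro F hF
  obtain ⟨F₀, ⟨hF₀, g, rfl⟩, -⟩ := hT.2 F hF
  rw [hinv.val g F₀ (hT.1 F₀ hF₀), G.pullback_mul]
  rw [boltzmann_eq_prod, Finset.prod_ne_zero_iff] at hσ
  have := hσ (G.act g v, F₀) (by simp [hF₀])
  rw [term, expBot_ne_zero_iff] at this
  intro h
  rw [h] at this
  exact this rfl

variable (T) in
open scoped Classical in
/-- The pairs of a translation and a member of the transversal whose translate meets `S`. -/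
def meetingPairs (S : Finset (TreeGroup κ m)) :
    Finset (TreeGroup κ m × Finset (TreeGroup κ m)) :=
  ((S ×ˢ T.biUnion id).image (fun q => q.1 * q.2⁻¹) ×ˢ T).filter
    fun q => ∃ b ∈ S, b ∈ translate q.1 q.2

/-- The finite candidate set in the definition loses nothing: $gf = b$ with $b \in S$ and $f \in F$
forces $g = bf^{-1}$. -/
theorem mem_meetingPairs {S : Finset (TreeGroup κ m)}
    {q : TreeGroup κ m × Finset (TreeGroup κ m)} :
    q ∈ meetingPairs T S ↔ q.2 ∈ T ∧ ∃ b ∈ S, b ∈ translate q.1 q.2 := by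
  classical
  simp only [meetingPairs, Finset.mem_filter, Finset.mem_product]
  refine ⟨fun h => ⟨h.1.2, h.2⟩, fun h => ⟨⟨?_, h.1⟩, h.2⟩⟩
  obtain ⟨hq, b, hb, hbq⟩ := h
  obtain ⟨f, hf, rfl⟩ := mem_translate.1 hbq
  refine Finset.mem_image.2 ⟨(q.1 * f, f), ?_, by simp⟩
  exact Finset.mem_product.2 ⟨hb, Finset.mem_biUnion.2 ⟨q.2, hq, hf⟩⟩

variable (Φ T) in
open scoped Classical in
/-- A finite set of group elements on which the covering has to be injective for the weights near
a vertex to be those of the tree. -/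
def window (S : Finset (TreeGroup κ m)) : Finset (TreeGroup κ m) :=
  S ∪ (Φ.finite_meeting S).toFinset.biUnion id ∪ (meetingPairs T S).image Prod.fst

theorem subset_window (S : Finset (TreeGroup κ m)) : S ⊆ Φ.window T S := by
  classical
  exact Finset.subset_union_left.trans Finset.subset_union_left

theorem mem_window_of_mem {S F : Finset (TreeGroup κ m)}
    (hF : F ∈ (Φ.finite_meeting S).toFinset) {g : TreeGroup κ m} (hg : g ∈ F) :
    g ∈ Φ.window T S := by
  classical
  exact Finset.mem_union_left _ (Finset.mem_union_right _ (Finset.mem_biUnion.2 ⟨F, hF, hg⟩))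

theorem fst_mem_window {S : Finset (TreeGroup κ m)}
    {q : TreeGroup κ m × Finset (TreeGroup κ m)} (hq : q ∈ meetingPairs T S) :
    q.1 ∈ Φ.window T S := by
  classical
  exact Finset.mem_union_right _ (Finset.mem_image_of_mem _ hq)

theorem mem_finite_meeting {S F : Finset (TreeGroup κ m)} :
    F ∈ (Φ.finite_meeting S).toFinset ↔ F ∈ Φ.sets ∧ ∃ v ∈ S, v ∈ F := by
  simp

theorem term_act (hinv : Φ.IsTranslationInvariant) (hT : Φ.IsTransversal T) {V : Type*}
    (G : LabelledGraph κ m V) (v : V) (σ : V → A) {g : TreeGroup κ m}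
    {F : Finset (TreeGroup κ m)} (hF : F ∈ T) :
    Φ.term G (G.act g v) F σ =
      expBot ((Φ.val (translate g F) ((translate g F).restrict (G.pullback v σ))).map
        fun x : ℝ => x / stabilizerCard F) := by
  rw [hinv.val g F (hT.1 F hF), G.pullback_mul, term]

/-- The factors at the translates that meet `S` multiply to the exponential of the local energy. -/
theorem prod_meetingPairs (hinv : Φ.IsTranslationInvariant) (hT : Φ.IsTransversal T) {V : Type*}
    (G : LabelledGraph κ m V) (v : V) (σ : V → A) (S : Finset (TreeGroup κ m)) :
    ∏ q ∈ meetingPairs T S, Φ.term G (G.act q.1 v) q.2 σ =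
      expBot (Φ.localEnergy S (G.pullback v σ)) := by
  classical
  rw [localEnergy, expBot_sum]
  rw [← Finset.prod_fiberwise_of_maps_to (g := fun q => translate q.1 q.2)
    (t := (Φ.finite_meeting S).toFinset)]
  · refine Finset.prod_congr rfl fun F hF => ?_
    obtain ⟨hFs, b, hb, hbF⟩ := mem_finite_meeting.1 hF
    obtain ⟨F₀, ⟨hF₀, g₀, hg₀⟩, huniq⟩ := hT.2 F hFs
    set fib := {q ∈ meetingPairs T S | translate q.1 q.2 = F} with hfib
    have hmem q : q ∈ fib ↔ q.2 = F₀ ∧ translate q.1 F₀ = F := by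
      rw [hfib, Finset.mem_filter, mem_meetingPairs]
      constructor
      · rintro ⟨⟨hq, -⟩, hqF⟩
        have := huniq q.2 ⟨hq, q.1, hqF⟩
        exact ⟨this, this ▸ hqF⟩
      · rintro ⟨hq, hqF⟩
        rw [hq, hqF]
        exact ⟨⟨hF₀, b, hb, hbF⟩, rfl⟩
    -- The translations that carry $F_0$ to $F$ form the coset $g_0\,\mathrm{Stab}(F_0)$.
    have hcard : fib.card = stabilizerCard F₀ := by
      have himage : (fib : Set (TreeGroup κ m × Finset (TreeGroup κ m))) =
          (fun g => (g₀ * g, F₀)) '' {g | translate g F₀ = F₀} := by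
        ext q
        rw [Finset.mem_coe, hmem]
        constructor
        · rintro ⟨h1, h2⟩
          refine ⟨g₀⁻¹ * q.1, ?_, ?_⟩
          · change translate _ _ = _
            rw [translate_mul, h2, ← hg₀, ← translate_mul, inv_mul_cancel, translate_one]
          · simp [← h1]
        · rintro ⟨g, hg, rfl⟩
          refine ⟨rfl, ?_⟩
          rw [translate_mul, show translate g F₀ = F₀ from hg, hg₀]
      rw [← Set.ncard_coe_finset, himage, Set.ncard_image_of_injective]
      · rfl
      · intro g h hgh
        exact mul_left_cancel (Prod.ext_iff.1 hgh).1
    have hne : stabilizerCard F₀ ≠ 0 := by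
      rw [← hcard, Finset.card_ne_zero]
      exact ⟨(g₀, F₀), (hmem _).2 ⟨rfl, hg₀⟩⟩
    rw [Finset.prod_congr rfl (g := fun _ => expBot ((Φ.val F (F.restrict (G.pullback v σ))).map
        fun x : ℝ => x / stabilizerCard F₀)), Finset.prod_const, hcard, expBot_map_div_pow _ hne]
    intro q hq
    obtain ⟨h1, h2⟩ := (hmem q).1 hq
    rw [h1, term_act hinv hT G v σ hF₀, h2]
  · intro q hq
    obtain ⟨hq, b, hb, hbq⟩ := mem_meetingPairs.1 hq
    exact mem_finite_meeting.2 ⟨hinv.sets _ _ (hT.1 _ hq), b, hb, hbq⟩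

variable (Φ T) in
open scoped Classical in
/-- The product of the Boltzmann factors that do not involve the spins in `B`. -/
def farFactor {V : Type*} [Fintype V] (G : LabelledGraph κ m V) (B : Finset V) (σ : V → A) : ℝ :=
  ∏ q ∈ (Finset.univ ×ˢ T).filter (fun q => ¬ ∃ f ∈ q.2, G.act f q.1 ∈ B), Φ.term G q.1 q.2 σ

theorem farFactor_congr {V : Type*} [Fintype V] (G : LabelledGraph κ m V) (B : Finset V)
    {σ τ : V → A} (h : ∀ u ∉ B, σ u = τ u) : Φ.farFactor T G B σ = Φ.farFactor T G B τ := by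
  classical
  refine Finset.prod_congr rfl fun q hq => ?_
  have hq' := (Finset.mem_filter.1 hq).2
  have : q.2.restrict (G.pullback q.1 σ) = q.2.restrict (G.pullback q.1 τ) := by
    funext f
    exact h _ fun hf => hq' ⟨f, f.2, hf⟩
  rw [term, term, this]

/-- Where the covering is injective, the Boltzmann weight factors into a part that does not involve
the spins near `v` and the Boltzmann weight of the lifted configuration on the tree. -/
theorem boltzmann_eq_farFactor_mul (hinv : Φ.IsTranslationInvariant) (hT : Φ.IsTransversal T)
    {V : Type*} [Fintype V] [DecidableEq V] (G : LabelledGraph κ m V) {v : V}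
    {S : Finset (TreeGroup κ m)}
    (hv : Set.InjOn (fun g => G.act g v) (Φ.window T S)) (σ : V → A) :
    Φ.boltzmann T G σ = Φ.farFactor T G (S.image fun g => G.act g v) σ *
      expBot (Φ.localEnergy S (G.pullback v σ)) := by
  classical
  rw [boltzmann_eq_prod, ← Finset.prod_filter_mul_prod_filter_not _
    (fun q => ∃ f ∈ q.2, G.act f q.1 ∈ S.image fun g => G.act g v), mul_comm]
  congr 1
  · exact Finset.prod_congr (by congr!) fun _ _ => rfl
  rw [← prod_meetingPairs hinv hT]
  symm
  -- Translates meeting $S$ in the tree correspond to factors touching the image of $S$ in the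
  -- graph. Injectivity holds because the window contains the translations themselves; a preimage is
  -- found by walking back from $b \in S$ along $f^{-1}$.
  refine Finset.prod_bij (fun q _ => (G.act q.1 v, q.2)) ?_ ?_ ?_ fun _ _ => rfl
  · intro q hq
    obtain ⟨hqT, b, hb, hbq⟩ := mem_meetingPairs.1 hq
    obtain ⟨f, hf, rfl⟩ := mem_translate.1 hbq
    simp only [Finset.mem_filter, Finset.mem_product, Finset.mem_univ, true_and]
    exact ⟨hqT, f, hf, Finset.mem_image.2 ⟨_, hb, G.act_mul _ _ _⟩⟩
  · intro q hq q' hq' h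
    obtain ⟨h1, h2⟩ := Prod.ext_iff.1 h
    exact Prod.ext (hv (fst_mem_window hq) (fst_mem_window hq') h1) h2
  · rintro ⟨w, F⟩ hq
    simp only [Finset.mem_filter, Finset.mem_product, Finset.mem_univ, true_and] at hq
    obtain ⟨hF, f, hf, hfw⟩ := hq
    obtain ⟨b, hb, hbf⟩ := Finset.mem_image.1 hfw
    refine ⟨(b * f⁻¹, F), mem_meetingPairs.2 ⟨hF, b, hb, mem_translate.2 ⟨f, hf, by simp⟩⟩, ?_⟩
    simp only [G.act_mul, hbf, G.act_inv_act]

theorem glue_of_mem {W : Type*} {S : Finset W} {ξ : S → A} {η : W → A} {g : W} (hg : g ∈ S) :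
    glue S ξ η g = ξ ⟨g, hg⟩ := by
  simp [glue, hg]

theorem glue_of_notMem {W : Type*} {S : Finset W} {ξ : S → A} {η : W → A} {g : W} (hg : g ∉ S) :
    glue S ξ η g = η g := by
  simp [glue, hg]

theorem glue_restrict_self {W : Type*} (S : Finset W) (η : W → A) :
    glue S (S.restrict η) η = η := by
  funext g
  by_cases hg : g ∈ S
  · rw [glue_of_mem hg]; rfl
  · rw [glue_of_notMem hg]

/-- The window contains every interaction set that meets $S$, so injectivity keeps the points of
these sets outside $S$ away from the image of $S$; there $\tau$ equals $\sigma$. -/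
theorem localEnergy_pullback_eq {V : Type*} [DecidableEq V] (G : LabelledGraph κ m V) {v : V}
    {S : Finset (TreeGroup κ m)} (hv : Set.InjOn (fun g => G.act g v) (Φ.window T S))
    {σ τ : V → A} (h : ∀ u ∉ S.image fun g => G.act g v, τ u = σ u) :
    Φ.localEnergy S (G.pullback v τ) =
      Φ.localEnergy S (glue S (S.restrict (G.pullback v τ)) (G.pullback v σ)) := by
  refine Finset.sum_congr rfl fun F hF => ?_
  congr 1
  funext ⟨g, hg⟩
  by_cases hgS : g ∈ S
  · simp only [Finset.restrict, glue_of_mem hgS]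
  · simp only [Finset.restrict, glue_of_notMem hgS]
    refine h _ fun hmem => hgS ?_
    obtain ⟨g', hg', hgg'⟩ := Finset.mem_image.1 hmem
    rwa [← hv (subset_window S hg') (mem_window_of_mem hF hg) hgg']

end Interaction

namespace Interaction

/-! ### Pinning spins by strong external fields -/

section pinned

variable {W A : Type*}

theorem localEnergy_ne_bot {Φ : Interaction W A} {η : W → A} (hη : η ∈ Φ.admissible)
    (S : Finset W) : Φ.localEnergy S η ≠ ⊥ := by
  rw [← expBot_ne_zero_iff, localEnergy, expBot_sum, Finset.prod_ne_zero_iff]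
  intro F hF
  rw [expBot_ne_zero_iff]
  exact hη F ((Set.Finite.mem_toFinset _).1 hF).1

open scoped Classical in
/-- The external field that penalizes deviations from `ζ` on `Q`. -/
def pinningField (Q : Finset W) (ζ : W → A) (K : ℕ) (g : W) (b : A) : ℝ :=
  if g ∈ Q ∧ b ≠ ζ g then -K else 0

/-- Each wrong spin on $Q$ costs a factor $e^{-K}$. Fields are real-valued, so exact pinning is
attained only in the limit. -/
theorem tendsto_exp_pinningField [DecidableEq W] {S Q : Finset W} (hQ : Q ⊆ S) (ζ : W → A)
    (η : W → A) (ξ : S → A) [Decidable (∀ g ∈ Q, glue S ξ η g = ζ g)] :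
    Tendsto (fun K : ℕ => Real.exp (∑ g : S, pinningField Q ζ K g (ξ g))) atTop
      (𝓝 (if ∀ g ∈ Q, glue S ξ η g = ζ g then 1 else 0)) := by
  classical
  split_ifs with h
  · have h0 (K : ℕ) : ∑ g : S, pinningField Q ζ K g (ξ g) = 0 := by
      refine Finset.sum_eq_zero fun g _ => if_neg ?_
      rintro ⟨hg, hne⟩
      exact hne (by rw [← h g hg, glue_of_mem g.2])
    simp only [h0, Real.exp_zero]
    exact tendsto_const_nhds
  · push Not at h
    obtain ⟨g, hg, hne⟩ := h
    rw [glue_of_mem (hQ hg)] at hne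
    refine squeeze_zero (fun K => (Real.exp_pos _).le) (fun K => Real.exp_le_exp.2
      (?_ : _ ≤ -(K : ℝ))) (Real.tendsto_exp_neg_atTop_nhds_zero.comp tendsto_natCast_atTop_atTop)
    have h1 : ∀ g' ∈ Finset.univ, g' ≠ (⟨g, hQ hg⟩ : S) → pinningField Q ζ K g' (ξ g') ≤ 0 := by
      intro g' _ _
      unfold pinningField
      split_ifs <;> simp
    rw [← Finset.add_sum_erase _ _ (Finset.mem_univ (⟨g, hQ hg⟩ : S))]
    have h2 : pinningField Q ζ K g (ξ ⟨g, hQ hg⟩) = -K := if_pos ⟨hg, hne⟩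
    rw [h2]
    have := Finset.sum_nonpos (s := (Finset.univ : Finset S).erase ⟨g, hQ hg⟩)
      (f := fun g' : S => pinningField Q ζ K g' (ξ g'))
      fun g' hg' => h1 g' (Finset.mem_univ _) (Finset.ne_of_mem_erase hg')
    linarith

variable [Fintype A]

open scoped Classical in
/-- The total Boltzmann weight, with boundary condition `η` off `S`, of the configurations on `S`
that agree with `ζ` on `Q` and satisfy `P`. -/
def pinnedWeight (Φ : Interaction W A) (S : Finset W) (η : W → A) (Q : Finset W) (ζ : W → A)
    (P : (W → A) → Prop) : ℝ :=
  ∑ ξ : S → A, if (∀ g ∈ Q, glue S ξ η g = ζ g) ∧ P (glue S ξ η) then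
    expBot (Φ.localEnergy S (glue S ξ η)) else 0

/-- The conditional probability that the spin at `v` is `a`, with boundary condition `η` off `S`,
given that the spins in `Q` agree with `ζ`. -/
def pinnedProb (Φ : Interaction W A) (S : Finset W) (η : W → A) (Q : Finset W) (ζ : W → A)
    (v : W) (a : A) : ℝ :=
  Φ.pinnedWeight S η Q ζ (fun σ => σ v = a) / Φ.pinnedWeight S η Q ζ fun _ => True

theorem pinnedWeight_pos {Φ : Interaction W A} {η ζ : W → A} (hη : η ∈ Φ.admissible)
    (S : Finset W) {Q : Finset W} (h : ∀ g ∈ Q, η g = ζ g) :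
    0 < Φ.pinnedWeight S η Q ζ fun _ => True := by
  classical
  refine Finset.sum_pos' (fun ξ _ => ?_) ⟨S.restrict η, Finset.mem_univ _, ?_⟩
  · split_ifs
    exacts [expBot_nonneg _, le_rfl]
  · rw [glue_restrict_self, if_pos ⟨h, trivial⟩]
    exact (expBot_nonneg _).lt_of_ne' (expBot_ne_zero_iff.2 (localEnergy_ne_bot hη S))

theorem tendsto_condProb_pinningField {Φ : Interaction W A} {S Q : Finset W} (hQ : Q ⊆ S)
    {η ζ : W → A} (hpos : Φ.pinnedWeight S η Q ζ (fun _ => True) ≠ 0) (v : W) (a : A) :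
    Tendsto (fun K : ℕ => Φ.condProb (pinningField Q ζ K) S η v a) atTop
      (𝓝 (Φ.pinnedProb S η Q ζ v a)) := by
  classical
  have key (ξ : S → A) : Tendsto (fun K : ℕ => Φ.condWeight (pinningField Q ζ K) S η ξ) atTop
      (𝓝 (if ∀ g ∈ Q, glue S ξ η g = ζ g then
        expBot (Φ.localEnergy S (glue S ξ η)) else 0)) := by
    have := (tendsto_exp_pinningField hQ ζ η ξ).const_mul
      (expBot (Φ.localEnergy S (glue S ξ η)))
    simp only [mul_ite, mul_one, mul_zero] at this
    simpa only [condWeight, expBot_add, expBot_coe] using this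
  refine Tendsto.div (tendsto_finsetSum _ fun ξ _ => ?_) ?_ hpos
  · by_cases h : glue S ξ η v = a
    · simpa only [h, if_true, and_true] using key ξ
    · simp only [h, if_false, and_false]
      exact tendsto_const_nhds
  · unfold pinnedWeight
    simp only [and_true]
    exact tendsto_finsetSum _ fun ξ _ => key ξ

/-- The bound holds for each pinning field and survives $K \to \infty$. This is where uniformity
over external fields enters: it turns mixing into mixing conditional on arbitrary spins in $Q$. -/
theorem abs_pinnedProb_sub_le {Φ : Interaction W A} {S Q : Finset W} (hQ : Q ⊆ S) {v : W} {a : A}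
    {ε : ℝ} {η τ ζ : W → A} (hη : η ∈ Φ.admissible) (hτ : τ ∈ Φ.admissible)
    (hηζ : ∀ g ∈ Q, η g = ζ g) (hτζ : ∀ g ∈ Q, τ g = ζ g)
    (h : ∀ Ψ : W → A → ℝ, |Φ.condProb Ψ S η v a - Φ.condProb Ψ S τ v a| ≤ ε) :
    |Φ.pinnedProb S η Q ζ v a - Φ.pinnedProb S τ Q ζ v a| ≤ ε :=
  le_of_tendsto' ((tendsto_condProb_pinningField hQ (pinnedWeight_pos hη S hηζ).ne' v a).sub
    (tendsto_condProb_pinningField hQ (pinnedWeight_pos hτ S hτζ).ne' v a)).abs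
    fun _ => h _

end pinned

/-! ### Gibbs measures on finite graphs -/

section gibbs

variable {κ : Labelling} {m : ℕ} {A : Type*} [Fintype A] {Φ : Interaction (TreeGroup κ m) A}
  {T : Finset (Finset (TreeGroup κ m))} {V : Type*} [Fintype V] {G : LabelledGraph κ m V}

variable (Φ T G) in
open scoped Classical in
/-- The partition function. -/
def partitionFunction : ℝ := ∑ σ : V → A, Φ.boltzmann T G σ

theorem partitionFunction_pos (hfin : ∃ σ : V → A, Φ.hamiltonian T G σ ≠ ⊥) :
    0 < Φ.partitionFunction T G := by
  classical
  obtain ⟨σ, hσ⟩ := hfin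
  refine Finset.sum_pos' (fun τ _ => Φ.boltzmann_nonneg T G τ) ⟨σ, Finset.mem_univ _, ?_⟩
  exact (Φ.boltzmann_nonneg T G σ).lt_of_ne' (expBot_ne_zero_iff.2 hσ)

/-- Configurations that agree with `σ` off the image of `S` correspond to configurations
on `S`. -/
theorem sum_restrict_pullback [DecidableEq V] {v : V} {S : Finset (TreeGroup κ m)}
    [DecidableEq S]
    (hv : Set.InjOn (fun g => G.act g v) S) (σ : V → A) (f : (S → A) → ℝ)
    [DecidablePred fun τ : V → A => ∀ u ∉ S.image fun g => G.act g v, τ u = σ u] :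
    ∑ τ ∈ Finset.univ.filter (fun τ : V → A => ∀ u ∉ S.image fun g => G.act g v, τ u = σ u),
      f (S.restrict (G.pullback v τ) : S → A) = ∑ ξ : S → A, f ξ := by
  classical
  refine Finset.sum_bij (fun τ _ => (S.restrict (G.pullback v τ) : S → A)) (fun _ _ => Finset.mem_univ _)
    ?_ ?_ fun _ _ => rfl
  · intro τ hτ τ' hτ' h
    funext u
    by_cases hu : u ∈ S.image fun g => G.act g v
    · obtain ⟨g, hg, rfl⟩ := Finset.mem_image.1 hu
      exact congrFun h ⟨g, hg⟩
    · rw [(Finset.mem_filter.1 hτ).2 u hu, (Finset.mem_filter.1 hτ').2 u hu]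
  · intro ξ _
    -- Push $\xi$ forward along the covering; injectivity makes the chosen preimage the right one.
    refine ⟨fun u => if h : ∃ g : S, G.act g v = u then ξ h.choose else σ u, ?_, ?_⟩
    · simp only [Finset.mem_filter, Finset.mem_univ, true_and]
      intro u hu
      rw [dif_neg]
      rintro ⟨g, rfl⟩
      exact hu (Finset.mem_image_of_mem _ g.2)
    · funext g
      have h : ∃ g' : S, G.act g' v = G.act g v := ⟨g, rfl⟩
      change (if h : ∃ g' : S, G.act g' v = G.act g v then ξ h.choose else σ _) = ξ g
      rw [dif_pos h]
      congr 1
      exact Subtype.ext (hv h.choose.2 g.2 h.choose_spec)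

variable [MeasurableSpace A] [MeasurableSingletonClass A]

open scoped Classical in
theorem gibbs_apply (s : Set (V → A)) : Φ.gibbs T G s = ENNReal.ofReal
    (∑ σ : V → A, if σ ∈ s then Φ.boltzmann T G σ / Φ.partitionFunction T G else 0) := by
  have hZ : 0 ≤ Φ.partitionFunction T G := Finset.sum_nonneg fun σ _ => Φ.boltzmann_nonneg T G σ
  have hs : MeasurableSet s := s.toFinite.measurableSet
  rw [gibbs, Measure.finsetSum_apply, ENNReal.ofReal_sum_of_nonneg]
  · refine Finset.sum_congr rfl fun σ _ => ?_
    rw [Measure.smul_apply, Measure.dirac_apply' _ hs]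
    by_cases h : σ ∈ s
    · simp only [h, Set.indicator_of_mem, Pi.one_apply, smul_eq_mul, mul_one, if_true]
      rfl
    · simp [h]
  · intro σ _
    split_ifs
    exacts [div_nonneg (Φ.boltzmann_nonneg T G σ) hZ, le_rfl]

open scoped Classical in
theorem gibbs_real (s : Set (V → A)) : (Φ.gibbs T G).real s =
    (∑ σ : V → A, if σ ∈ s then Φ.boltzmann T G σ else 0) / Φ.partitionFunction T G := by
  have hZ : 0 ≤ Φ.partitionFunction T G := Finset.sum_nonneg fun σ _ => Φ.boltzmann_nonneg T G σ
  rw [measureReal_def, gibbs_apply, ENNReal.toReal_ofReal, Finset.sum_div]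
  · exact Finset.sum_congr rfl fun σ _ => by split_ifs <;> simp
  · refine Finset.sum_nonneg fun σ _ => ?_
    split_ifs
    exacts [div_nonneg (Φ.boltzmann_nonneg T G σ) hZ, le_rfl]

theorem isProbabilityMeasure_gibbs (hfin : ∃ σ : V → A, Φ.hamiltonian T G σ ≠ ⊥) :
    IsProbabilityMeasure (Φ.gibbs T G) := by
  classical
  refine ⟨?_⟩
  rw [gibbs_apply]
  simp only [Set.mem_univ, if_true]
  rw [← Finset.sum_div]
  have : ∑ σ : V → A, Φ.boltzmann T G σ = Φ.partitionFunction T G := rfl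
  rw [this, div_self (partitionFunction_pos hfin).ne', ENNReal.ofReal_one]

/-- An event of positive probability contains a configuration of positive weight. -/
theorem exists_boltzmann_ne_zero {s : Set (V → A)} (hs : 0 < (Φ.gibbs T G).real s) :
    ∃ σ ∈ s, Φ.boltzmann T G σ ≠ 0 := by
  classical
  by_contra! h
  rw [gibbs_real, Finset.sum_eq_zero, zero_div] at hs
  · exact hs.false
  · intro σ _
    split_ifs with hσ
    exacts [h σ hσ, rfl]

/-- The Markov property: conditional distributions of spins near `v`, given all spins far
from `v`, are those of the tree. -/
theorem gibbs_real_agreeSet [DecidableEq V] (hinv : Φ.IsTranslationInvariant)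
    (hT : Φ.IsTransversal T) {v : V} {S Q : Finset (TreeGroup κ m)} (hQ : Q ⊆ S)
    (hv : Set.InjOn (fun g => G.act g v) (Φ.window T S)) (σ : V → A) {g : TreeGroup κ m}
    (hg : g ∈ S) (P : A → Prop) :
    (Φ.gibbs T G).real ({τ | P (τ (G.act g v))} ∩ agreeSet ((Q.image fun g => G.act g v) ∪
        (S.image fun g => G.act g v)ᶜ) σ) =
      Φ.farFactor T G (S.image fun g => G.act g v) σ / Φ.partitionFunction T G *
        Φ.pinnedWeight S (G.pullback v σ) Q (G.pullback v σ) fun τ => P (τ g) := by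
  classical
  rw [gibbs_real, pinnedWeight, div_mul_eq_mul_div]
  congr 1
  rw [Finset.mul_sum, ← sum_restrict_pullback (G := G) (hv.mono (subset_window S)) σ,
    Finset.sum_filter]
  refine Finset.sum_congr (Finset.ext fun _ => by simp) fun τ _ => ?_
  by_cases hτ : ∀ u ∉ S.image fun g => G.act g v, τ u = σ u
  · rw [if_pos hτ]
    have hglue : ∀ g' ∈ S, glue S (S.restrict (G.pullback v τ)) (G.pullback v σ) g' =
        τ (G.act g' v) := fun g' hg' => glue_of_mem hg'
    have hiff : τ ∈ {τ : V → A | P (τ (G.act g v))} ∩ agreeSet ((Q.image fun g => G.act g v) ∪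
        (S.image fun g => G.act g v)ᶜ) σ ↔
        (∀ g' ∈ Q, glue S (S.restrict (G.pullback v τ)) (G.pullback v σ) g' =
          G.pullback v σ g') ∧
        P (glue S (S.restrict (G.pullback v τ)) (G.pullback v σ) g) := by
      rw [hglue g hg, and_comm]
      refine and_congr Iff.rfl ?_
      constructor
      · intro h g' hg'
        rw [hglue g' (hQ hg')]
        exact h _ (Finset.mem_union_left _ (Finset.mem_image_of_mem _ hg'))
      · intro h u hu
        rcases Finset.mem_union.1 hu with hu | hu
        · obtain ⟨g', hg', rfl⟩ := Finset.mem_image.1 hu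
          have := h g' hg'
          rwa [hglue g' (hQ hg')] at this
        · exact hτ u (Finset.mem_compl.1 hu)
    simp only [hiff, mul_ite, mul_zero]
    refine if_congr Iff.rfl ?_ rfl
    rw [boltzmann_eq_farFactor_mul hinv hT G hv τ, farFactor_congr G _ hτ,
      localEnergy_pullback_eq G hv hτ]
  · rw [if_neg hτ, if_neg]
    rintro ⟨-, h⟩
    exact hτ fun u hu => h u (Finset.mem_union_right _ (Finset.mem_compl.2 hu))

/-- The far factor and the partition function occur in both numerator and denominator and cancel,
leaving a ratio of weights on the tree. -/
theorem spinProb_gibbs [DecidableEq V] (hinv : Φ.IsTranslationInvariant)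
    (hT : Φ.IsTransversal T) {v : V} {S Q : Finset (TreeGroup κ m)} (hQ : Q ⊆ S)
    (hv : Set.InjOn (fun g => G.act g v) (Φ.window T S)) {σ : V → A}
    (hσ : Φ.boltzmann T G σ ≠ 0) (hS : 1 ∈ S) (a : A) :
    spinProb (Φ.gibbs T G) v ((Q.image fun g => G.act g v) ∪
        (S.image fun g => G.act g v)ᶜ) σ a =
      Φ.pinnedProb S (G.pullback v σ) Q (G.pullback v σ) 1 a := by
  have h1 := gibbs_real_agreeSet hinv hT hQ hv σ hS (· = a)
  have h2 := gibbs_real_agreeSet hinv hT hQ hv σ hS fun _ => True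
  rw [G.act_one] at h1
  simp only [Set.ofPred_true, Set.univ_inter] at h2
  have hZ : Φ.partitionFunction T G ≠ 0 :=
    (partitionFunction_pos ⟨σ, expBot_ne_zero_iff.1 hσ⟩).ne'
  have hfar : Φ.farFactor T G (S.image fun g => G.act g v) σ ≠ 0 := by
    rw [boltzmann_eq_farFactor_mul hinv hT G hv σ] at hσ
    exact left_ne_zero_of_mul hσ
  rw [spinProb, h1, h2, pinnedProb, mul_div_mul_left _ _ (div_ne_zero hfar hZ)]

/-- Strong spatial mixing: given the spins in a subset of a ball, the spins outside of the ball
hardly contain further information on the spin at the centre. -/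
theorem condEntropy_gibbs_le_add [DecidableEq V] (hinv : Φ.IsTranslationInvariant)
    (hT : Φ.IsTransversal T) {v : V} {S Q : Finset (TreeGroup κ m)} (hQ : Q ⊆ S) (hS : 1 ∈ S)
    (hv : Set.InjOn (fun g => G.act g v) (Φ.window T S))
    (hfin : ∃ σ : V → A, Φ.hamiltonian T G σ ≠ ⊥) {ε ω : ℝ}
    (hω : ∀ x ∈ Set.Icc (0 : ℝ) 1, ∀ y ∈ Set.Icc (0 : ℝ) 1, |x - y| ≤ ε →
      |Real.negMulLog x - Real.negMulLog y| ≤ ω)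
    (hmix : ∀ Ψ : TreeGroup κ m → A → ℝ, ∀ η ∈ Φ.admissible, ∀ τ ∈ Φ.admissible, ∀ a : A,
      |Φ.condProb Ψ S η 1 a - Φ.condProb Ψ S τ 1 a| ≤ ε) :
    condEntropy (Φ.gibbs T G) v (Q.image fun g => G.act g v : Finset V) ≤
      condEntropy (Φ.gibbs T G) v ((Q.image fun g => G.act g v) ∪
        (S.image fun g => G.act g v)ᶜ : Finset V) + Fintype.card A * ω := by
  have := isProbabilityMeasure_gibbs (Φ := Φ) (T := T) (G := G) hfin
  refine condEntropy_le_add _ Finset.subset_union_left hω fun a σ τ hσ hτ hτσ => ?_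
  -- Only the cylinders of $\sigma$ and $\tau$ have positive probability; the configurations
  -- themselves may have weight zero. They are replaced by members of positive weight, whose lifts
  -- are admissible boundary conditions.
  obtain ⟨σ', hσ', hσW⟩ := exists_boltzmann_ne_zero hσ
  obtain ⟨τ', hτ', hτW⟩ := exists_boltzmann_ne_zero hτ
  have hQσ : ∀ g ∈ Q, G.pullback v τ' g = G.pullback v σ' g := by
    intro g hg
    have hg' := Finset.mem_image_of_mem (fun g => G.act g v) hg
    have h1 := hσ' _ (Finset.mem_union_left _ hg')
    have h2 := hτ' _ (Finset.mem_union_left _ hg')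
    exact h2.trans ((hτσ _ hg').trans h1.symm)
  have e1 := spinProb_gibbs hinv hT hQ hv hσW hS a
  have e2 := spinProb_gibbs hinv hT hQ hv hτW hS a
  rw [spinProb, agreeSet_eq_of_mem hσ'] at e1
  rw [spinProb, agreeSet_eq_of_mem hτ'] at e2
  have e3 : Φ.pinnedProb S (G.pullback v τ') Q (G.pullback v τ') 1 a =
      Φ.pinnedProb S (G.pullback v τ') Q (G.pullback v σ') 1 a := by
    have hw (P : (TreeGroup κ m → A) → Prop) : Φ.pinnedWeight S (G.pullback v τ') Q (G.pullback v τ') P =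
        Φ.pinnedWeight S (G.pullback v τ') Q (G.pullback v σ') P := by
      classical
      refine Finset.sum_congr rfl fun ξ _ => if_congr (and_congr ?_ Iff.rfl) rfl rfl
      exact forall₂_congr fun g hg => by rw [hQσ g hg]
    rw [pinnedProb, pinnedProb, hw, hw]
  rw [spinProb, spinProb, e1, e2, e3]
  exact abs_pinnedProb_sub_le hQ (pullback_mem_admissible hinv hT hτW v)
    (pullback_mem_admissible hinv hT hσW v) hQσ (fun _ _ => rfl)
    fun Ψ => hmix Ψ _ (pullback_mem_admissible hinv hT hτW v) _
      (pullback_mem_admissible hinv hT hσW v) a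

end gibbs

end Interaction

/-! ### Entropy as a sum of vertex contributions -/

section vertex

/-- The average of `bernAvg p B f` over `p ∈ [0, 1]`. -/
def bernIntegral {V : Type*} [DecidableEq V] (B : Finset V) (f : Finset V → ℝ) : ℝ :=
  ∫ p in (0 : ℝ)..1, bernAvg p B f

theorem bernIntegral_le_add {V : Type*} [DecidableEq V] {B : Finset V} {f g : Finset V → ℝ}
    {c : ℝ} (h : ∀ S ⊆ B, f S ≤ g S + c) : bernIntegral B f ≤ bernIntegral B g + c := by
  have hc : bernIntegral B g + c = ∫ p in (0 : ℝ)..1, bernAvg p B fun S => g S + c := by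
    simp only [bernAvg_add, bernAvg_const]
    rw [intervalIntegral.integral_add ((continuous_bernAvg B g).intervalIntegrable 0 1)
      intervalIntegrable_const]
    simp [bernIntegral]
  rw [hc]
  exact intervalIntegral.integral_mono_on zero_le_one
    ((continuous_bernAvg B _).intervalIntegrable 0 1)
    ((continuous_bernAvg B _).intervalIntegrable 0 1) fun p hp => bernAvg_mono hp h

theorem bernIntegral_const {V : Type*} [DecidableEq V] (B : Finset V) (c : ℝ) :
    bernIntegral B (fun _ => c) = c := by
  simp [bernIntegral, bernAvg_const]

theorem bernIntegral_mem_Icc {V : Type*} [DecidableEq V] {B : Finset V} {f : Finset V → ℝ} {c : ℝ}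
    (h : ∀ S, f S ∈ Set.Icc 0 c) : bernIntegral B f ∈ Set.Icc 0 c := by
  have h0 := bernIntegral_le_add (B := B) (f := fun _ => (0 : ℝ)) (g := f) (c := 0)
    fun S _ => by simpa using (h S).1
  have h1 := bernIntegral_le_add (B := B) (f := f) (g := fun _ => c) (c := 0)
    fun S _ => by simpa using (h S).2
  rw [bernIntegral_const, add_zero] at h0 h1
  exact ⟨h0, h1⟩

theorem abs_localPercolativeEntropy_sub_le {κ : Labelling} {m : ℕ} {A : Type*} [Fintype A]
    [MeasurableSpace A] {B : Finset (TreeGroup κ m)} {P Q : Measure (TreeGroup κ m → A)} {ε : ℝ}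
    (h : ∀ S ⊆ B, |condEntropy P 1 (S : Set (TreeGroup κ m)) -
      condEntropy Q 1 (S : Set (TreeGroup κ m))| ≤ ε) :
    |localPercolativeEntropy P B - localPercolativeEntropy Q B| ≤ ε := by
  classical
  have h' (S) (hS : S ⊆ B) := abs_le.1 (h (S.erase 1) ((Finset.erase_subset _ _).trans hS))
  have h1 := bernIntegral_le_add (B := B) (c := ε)
    (f := fun S => condEntropy P 1 (S.erase 1 : Finset (TreeGroup κ m)))
    (g := fun S => condEntropy Q 1 (S.erase 1 : Finset (TreeGroup κ m)))
    fun S hS => by linarith [(h' S hS).2]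
  have h2 := bernIntegral_le_add (B := B) (c := ε)
    (f := fun S => condEntropy Q 1 (S.erase 1 : Finset (TreeGroup κ m)))
    (g := fun S => condEntropy P 1 (S.erase 1 : Finset (TreeGroup κ m)))
    fun S hS => by linarith [(h' S hS).1]
  have e (R : Measure (TreeGroup κ m → A)) : localPercolativeEntropy R B = bernIntegral B
      fun S => condEntropy R 1 (S.erase 1 : Finset (TreeGroup κ m)) := by
    unfold localPercolativeEntropy bernIntegral
    congr!
  rw [e, e, abs_le]
  constructor <;> linarith

variable {A : Type*} [Fintype A] [MeasurableSpace A] [MeasurableSingletonClass A]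

theorem condEntropy_mem_Icc {V : Type*} (P : Measure (V → A)) [IsProbabilityMeasure P] (v : V)
    (S : Set V) : condEntropy P v S ∈ Set.Icc (0 : ℝ) (Fintype.card A) :=
  ⟨condEntropy_nonneg P v S, condEntropy_le P v S⟩

variable {V : Type*} [Fintype V] [DecidableEq V]

/-- The average conditional entropy of the spin at `v`, given the spins in a Bernoulli random set
with uniformly distributed parameter. -/
def vertexEntropy (P : Measure (V → A)) (v : V) : ℝ :=
  bernIntegral Finset.univ fun S => condEntropy P v (S.erase v : Finset V)

variable (P : Measure (V → A)) [IsProbabilityMeasure P]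

theorem vertexEntropy_mem_Icc (v : V) :
    vertexEntropy P v ∈ Set.Icc (0 : ℝ) (Fintype.card A) :=
  bernIntegral_mem_Icc fun _ => condEntropy_mem_Icc P v _

/-- The chain rule, averaged over the orderings of the vertices. -/
theorem shannonEntropy_eq_sum_vertexEntropy :
    shannonEntropy P = ∑ v, vertexEntropy P v := by
  have := sub_eq_integral_bernAvg Finset.univ (blockEntropy P)
  rw [blockEntropy_univ, blockEntropy_empty, sub_zero] at this
  rw [this]
  refine Finset.sum_congr rfl fun v _ => ?_
  -- So the increment at $v$ in Russo's formula is the conditional entropy of $\sigma_v$ given $S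
  -- \setminus \{v\}$.
  have h (S : Finset V) : insert v (S.erase v) = insert v S := by
    ext u
    by_cases hu : u = v <;> simp [hu]
  simp only [vertexEntropy, bernIntegral, condEntropy_eq_blockEntropy_sub, h]

variable {κ : Labelling} {m : ℕ} {G : LabelledGraph κ m V} {v : V}
  {B : Finset (TreeGroup κ m)}

/-- A Bernoulli subset of the graph, intersected with the image of $B$, is the image of a Bernoulli
subset of $B$, since the covering is injective there. -/
theorem localPercolativeEntropy_pullback (hv : Set.InjOn (fun g => G.act g v) B) (hB : 1 ∈ B) :
    localPercolativeEntropy (P.map (G.pullback v)) B =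
      bernIntegral Finset.univ fun S =>
        condEntropy P v ((S ∩ B.image fun g => G.act g v).erase v : Finset V) := by
  classical
  rw [bernIntegral]
  simp only [bernAvg_inter _ (Finset.subset_univ (B.image fun g => G.act g v))
    (fun S => condEntropy P v (S.erase v : Finset V)), bernAvg_image _ hv]
  rw [localPercolativeEntropy]
  refine intervalIntegral.integral_congr fun p _ => bernAvg_congr p fun S hS => ?_
  have h := condEntropy_map P (fun g => G.act g v) 1 (S.erase 1)
  rw [G.act_one] at h
  refine (Eq.trans ?_ h).trans ?_
  · congr!
  · congr 2
    ext u
    simp only [Finset.mem_image, Finset.mem_erase]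
    constructor
    · rintro ⟨g, ⟨hg1, hg⟩, rfl⟩
      refine ⟨fun h => hg1 (hv (hS hg) hB ?_), g, hg, rfl⟩
      simpa using h
    · rintro ⟨hu, g, hg, rfl⟩
      exact ⟨g, ⟨fun h => hu (by rw [h, G.act_one]), hg⟩, rfl⟩

/-- Forgetting the revealed spins outside the image of $B$ only increases conditional entropy. -/
theorem vertexEntropy_le_localPercolativeEntropy (hv : Set.InjOn (fun g => G.act g v) B)
    (hB : 1 ∈ B) : vertexEntropy P v ≤ localPercolativeEntropy (P.map (G.pullback v)) B := by
  rw [localPercolativeEntropy_pullback P hv hB]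
  refine (bernIntegral_le_add (c := 0) fun S _ => ?_).trans (add_zero _).le
  rw [add_zero]
  exact condEntropy_anti P v
    (Finset.coe_subset.2 (Finset.erase_subset_erase v Finset.inter_subset_left))

/-- The converse comparison, up to the mixing error: even revealing every spin outside the image of
$B$ lowers the entropy by at most $|A|\omega$. -/
theorem localPercolativeEntropy_gibbs_le {Φ : Interaction (TreeGroup κ m) A}
    {T : Finset (Finset (TreeGroup κ m))} (hinv : Φ.IsTranslationInvariant)
    (hT : Φ.IsTransversal T) (hfin : ∃ σ : V → A, Φ.hamiltonian T G σ ≠ ⊥) (hB : 1 ∈ B)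
    (hv : Set.InjOn (fun g => G.act g v) (Φ.window T B)) {ε ω : ℝ}
    (hω : ∀ x ∈ Set.Icc (0 : ℝ) 1, ∀ y ∈ Set.Icc (0 : ℝ) 1, |x - y| ≤ ε →
      |Real.negMulLog x - Real.negMulLog y| ≤ ω)
    (hmix : ∀ Ψ : TreeGroup κ m → A → ℝ, ∀ η ∈ Φ.admissible, ∀ τ ∈ Φ.admissible, ∀ a : A,
      |Φ.condProb Ψ B η 1 a - Φ.condProb Ψ B τ 1 a| ≤ ε) :
    localPercolativeEntropy ((Φ.gibbs T G).map (G.pullback v)) B ≤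
      vertexEntropy (Φ.gibbs T G) v + Fintype.card A * ω := by
  classical
  have := Interaction.isProbabilityMeasure_gibbs (Φ := Φ) (T := T) (G := G) hfin
  rw [localPercolativeEntropy_pullback _ (hv.mono (Interaction.subset_window B)) hB]
  refine bernIntegral_le_add fun S _ => ?_
  set Q := B.filter fun g => G.act g v ∈ S.erase v with hQ
  have himage : (S ∩ B.image fun g => G.act g v).erase v = Q.image fun g => G.act g v := by
    ext u
    simp only [hQ, Finset.mem_erase, Finset.mem_inter, Finset.mem_image, Finset.mem_filter]
    constructor
    · rintro ⟨hu, huS, g, hg, rfl⟩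
      exact ⟨g, ⟨hg, hu, huS⟩, rfl⟩
    · rintro ⟨g, ⟨hg, hu, huS⟩, rfl⟩
      exact ⟨hu, huS, g, hg, rfl⟩
  rw [himage]
  -- $S \setminus \{v\}$ is contained in the image of $Q$ together with everything outside the image
  -- of $B$, so monotonicity gives the rest.
  refine (Interaction.condEntropy_gibbs_le_add hinv hT (Finset.filter_subset _ B) hB hv hfin hω
    hmix).trans (add_le_add_left (condEntropy_anti _ v (Finset.coe_subset.2 ?_)) _)
  intro u hu
  rw [Finset.mem_union, ← himage, Finset.mem_compl]
  by_cases huB : u ∈ B.image fun g => G.act g v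
  · left
    rw [Finset.mem_erase] at hu ⊢
    exact ⟨hu.1, Finset.mem_inter.2 ⟨hu.2, huB⟩⟩
  · exact Or.inr huB

theorem localPercolativeEntropy_mem_Icc (μ : Measure (TreeGroup κ m → A)) [IsProbabilityMeasure μ]
    (B : Finset (TreeGroup κ m)) :
    localPercolativeEntropy μ B ∈ Set.Icc (0 : ℝ) (Fintype.card A) := by
  classical
  exact bernIntegral_mem_Icc fun _ => condEntropy_mem_Icc μ 1 _

end vertex

/-! ### Asymptotics of the entropy of Gibbs measures -/

section limit

variable {κ : Labelling} {m : ℕ} {A : Type*} [Fintype A] [MeasurableSpace A]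
  [MeasurableSingletonClass A] {Φ : Interaction (TreeGroup κ m) A}
  {T : Finset (Finset (TreeGroup κ m))} {V : ℕ → Type*} [∀ n, Fintype (V n)]
  [∀ n, Nonempty (V n)] {G : ∀ n, LabelledGraph κ m (V n)}
  {μ : Measure (TreeGroup κ m → A)} [IsProbabilityMeasure μ]

/-- At most vertices the graph looks like the tree and the Gibbs measure looks like its local
limit. -/
theorem exists_bad_vertices (hG : LocallyConverges G)
    (hfin : ∀ n, ∃ σ : V n → A, Φ.hamiltonian T (G n) σ ≠ ⊥)
    (hμ : LocalWeakStar G (fun n => Φ.gibbs T (G n)) μ) (r : ℕ) {ε : ℝ} (hε : 0 < ε) :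
    ∃ bad : ∀ n, V n → Prop, Tendsto (fun n => uniformProb (bad n)) atTop (𝓝 0) ∧
      ∀ n v, ¬ bad n v →
        Set.InjOn (fun g => (G n).act g v) (Φ.window T (treeBall κ m r)) ∧
        |localPercolativeEntropy ((Φ.gibbs T (G n)).map ((G n).pullback v)) (treeBall κ m r) -
          localPercolativeEntropy μ (treeBall κ m r)| ≤ ε := by
  classical
  obtain ⟨δ, hδ, h⟩ := exists_tvDist_condEntropy (A := A) (treeBall κ m r) hε
  have h0 := (tendsto_uniformProb_not_injOn hG (Φ.window T (treeBall κ m r))).add (hμ r δ hδ)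
  rw [add_zero] at h0
  refine ⟨_, tendsto_of_tendsto_of_tendsto_of_le_of_le tendsto_const_nhds h0
    (fun n => uniformProb_nonneg _) (fun n => uniformProb_or_le _ _), fun n v hv => ?_⟩
  simp only [not_or, not_not, not_lt] at hv
  refine ⟨hv.1, abs_localPercolativeEntropy_sub_le fun S hS => ?_⟩
  have := Interaction.isProbabilityMeasure_gibbs (Φ := Φ) (T := T) (G := G n) (hfin n)
  have hm : Measurable fun σ : V n → A => (G n).pullback v σ := by
    unfold LabelledGraph.pullback
    fun_prop
  have := Measure.isProbabilityMeasure_map (μ := Φ.gibbs T (G n)) hm.aemeasurable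
  refine h _ μ ?_ 1 (one_mem_treeBall r) S hS
  rw [Measure.map_map (measurable_restrict _) hm]
  exact hv.2

theorem eventually_entropy_le (hG : LocallyConverges G)
    (hfin : ∀ n, ∃ σ : V n → A, Φ.hamiltonian T (G n) σ ≠ ⊥)
    (hμ : LocalWeakStar G (fun n => Φ.gibbs T (G n)) μ) {ε : ℝ} (hε : 0 < ε) :
    ∀ᶠ n in atTop, shannonEntropy (Φ.gibbs T (G n)) / (Fintype.card (V n) : ℝ) ≤
      percolativeEntropy μ + ε := by
  classical
  obtain ⟨r, hr⟩ := ((tendsto_localPercolativeEntropy μ).eventually_le_const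
    (lt_add_of_pos_right _ (by positivity : 0 < ε / 3))).exists
  obtain ⟨bad, hbad, hgood⟩ := exists_bad_vertices hG hfin hμ r (by positivity : 0 < ε / 3)
  have hsmall := (hbad.const_mul (Fintype.card A : ℝ)).eventually_le_const
    (by simpa using (by positivity : 0 < ε / 3) : (Fintype.card A : ℝ) * 0 < ε / 3)
  filter_upwards [hsmall] with n hn
  have := Interaction.isProbabilityMeasure_gibbs (Φ := Φ) (T := T) (G := G n) (hfin n)
  have hI := localPercolativeEntropy_mem_Icc μ (treeBall κ m r)
  rw [shannonEntropy_eq_sum_vertexEntropy]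
  -- The three thirds of $\varepsilon$ pay for truncating $H_{perc}(\mu)$ to radius $r$, for
  -- comparing local laws at good vertices, and for the bad vertices.
  refine (sum_div_card_le (bad := bad n) (M := Fintype.card A)
    (c := localPercolativeEntropy μ (treeBall κ m r) + ε / 3) (fun v hv => ?_)
    (fun v => ?_)).trans (by linarith)
  · obtain ⟨h1, h2⟩ := hgood n v hv
    have := vertexEntropy_le_localPercolativeEntropy (Φ.gibbs T (G n))
      (h1.mono (Interaction.subset_window _)) (one_mem_treeBall r)
    linarith [(abs_le.1 h2).2]
  · linarith [(vertexEntropy_mem_Icc (Φ.gibbs T (G n)) v).2, hI.1]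

theorem eventually_le_entropy (hinv : Φ.IsTranslationInvariant) (hT : Φ.IsTransversal T)
    (hG : LocallyConverges G)
    (hfin : ∀ n, ∃ σ : V n → A, Φ.hamiltonian T (G n) σ ≠ ⊥)
    (hμ : LocalWeakStar G (fun n => Φ.gibbs T (G n)) μ) (hmix : Φ.StrongSpatialMixing)
    {ε : ℝ} (hε : 0 < ε) :
    ∀ᶠ n in atTop, percolativeEntropy μ - ε ≤
      shannonEntropy (Φ.gibbs T (G n)) / (Fintype.card (V n) : ℝ) := by
  classical
  obtain ⟨ω, hω, hωε⟩ : ∃ ω > 0, Fintype.card A * ω ≤ ε / 4 := by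
    refine ⟨ε / 4 / (Fintype.card A + 1), by positivity, ?_⟩
    rw [← mul_div_assoc, div_le_iff₀ (by positivity)]
    nlinarith
  obtain ⟨η, hη, hmod⟩ := exists_negMulLog_modulus hω
  obtain ⟨R, hR⟩ := hmix η hη
  -- One radius must serve both the truncation of $H_{perc}(\mu)$ and the mixing bound, hence $r \ge
  -- R$.
  obtain ⟨r, hr, hrR⟩ := (((tendsto_localPercolativeEntropy μ).eventually_const_le
    (sub_lt_self _ (by positivity : 0 < ε / 4))).and (eventually_ge_atTop R)).exists
  obtain ⟨bad, hbad, hgood⟩ := exists_bad_vertices hG hfin hμ r (by positivity : 0 < ε / 4)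
  have hsmall := (hbad.const_mul (Fintype.card A : ℝ)).eventually_le_const
    (by simpa using (by positivity : 0 < ε / 4) : (Fintype.card A : ℝ) * 0 < ε / 4)
  filter_upwards [hsmall] with n hn
  have := Interaction.isProbabilityMeasure_gibbs (Φ := Φ) (T := T) (G := G n) (hfin n)
  have hI := localPercolativeEntropy_mem_Icc μ (treeBall κ m r)
  rw [shannonEntropy_eq_sum_vertexEntropy]
  -- Of the two quarters in $c$, one pays for comparing local laws and one for the mixing error
  -- $|A|\omega$.
  refine le_trans (by linarith) (le_sum_div_card (bad := bad n) (M := Fintype.card A)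
    (c := localPercolativeEntropy μ (treeBall κ m r) - ε / 4 - ε / 4) (fun v hv => ?_)
    (fun v => ?_))
  · obtain ⟨h1, h2⟩ := hgood n v hv
    have := localPercolativeEntropy_gibbs_le hinv hT (hfin n) (one_mem_treeBall r) h1 hmod
      (hR r hrR)
    linarith [(abs_le.1 h2).1]
  · linarith [(vertexEntropy_mem_Icc (Φ.gibbs T (G n)) v).1, hI.2]

end limit

end

end TreeGibbs

/-! ### Limits of the entropy density -/

theorem theorem1 (κ : TreeGibbs.Labelling) (m : ℕ) (hm : 1 ≤ m)
    {A : Type*} [Fintype A] [MeasurableSpace A] [MeasurableSingletonClass A]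
    (Φ : TreeGibbs.Interaction (TreeGibbs.TreeGroup κ m) A)
    (hinv : Φ.IsTranslationInvariant) (hrange : Φ.IsFiniteRange)
    (T : Finset (Finset (TreeGibbs.TreeGroup κ m))) (hT : Φ.IsTransversal T)
    {V : ℕ → Type*} [∀ n, Fintype (V n)] [∀ n, Nonempty (V n)]
    (G : ∀ n, TreeGibbs.LabelledGraph κ m (V n)) (hG : TreeGibbs.LocallyConverges G)
    (hfin : ∀ n, ∃ σ : V n → A, Φ.hamiltonian T (G n) σ ≠ ⊥)
    (μ : Measure (TreeGibbs.TreeGroup κ m → A)) [IsProbabilityMeasure μ]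
    (hμ : TreeGibbs.LocalWeakStar G (fun n => Φ.gibbs T (G n)) μ) :
    limsup (fun n => ((TreeGibbs.shannonEntropy (Φ.gibbs T (G n)) / (Fintype.card (V n) : ℝ) :
        ℝ) : EReal)) atTop ≤ (TreeGibbs.percolativeEntropy μ : EReal) ∧
    (Φ.StrongSpatialMixing →
      Tendsto (fun n => TreeGibbs.shannonEntropy (Φ.gibbs T (G n)) / (Fintype.card (V n) : ℝ))
        atTop (𝓝 (TreeGibbs.percolativeEntropy μ))) := by
  -- It suffices to bound the limsup by each real $z > H_{perc}(\mu)$; in `EReal` the limsup needs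
  -- no separate boundedness argument.
  refine ⟨EReal.le_of_forall_lt_iff_le.1 fun z hz => ?_, fun hmix => ?_⟩
  · refine limsup_le_of_le (by isBoundedDefault) ?_
    have hz' : 0 < z - TreeGibbs.percolativeEntropy μ := sub_pos.2 (EReal.coe_lt_coe_iff.1 hz)
    filter_upwards [TreeGibbs.eventually_entropy_le hG hfin hμ hz'] with n hn
    exact EReal.coe_le_coe_iff.2 (by linarith)
  · rw [Metric.tendsto_nhds]
    intro ε hε
    filter_upwards [TreeGibbs.eventually_entropy_le hG hfin hμ (half_pos hε),
      TreeGibbs.eventually_le_entropy hinv hT hG hfin hμ hmix (half_pos hε)] with n h1 h2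
    rw [Real.dist_eq, abs_lt]
    constructor <;> linarith
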